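/- Gradings are by the multiplicative group $\Gamma=\mathbb{R}_{>0}$. Let $k$ be a graded field (a nonzero commutative $\Gamma$-graded ring in which every nonzero homogeneous element is invertible) whose degree-$1$ part $k_1$ (a field) has characteristic $p>0$. Let $n\ge 1$, let $\bar k$ be a graded algebraic closure of $k$, and let $\ell=k^{p^{-n}}=\{a\in\bar k: a^{p^n}\in k\}$ with the induced grading. Let $B=k[T]$ with $T$ of degree $1\in\Gamma$, and let $H^1(\ell/k,\mathbf{Aut}^{\rm gr}B)$ be the set of isomorphism classes of graded forms of $B$, i.e. of graded $k$-algebras $A$ with $\ell\otimes_kA\cong \ell\otimes_kB$ as graded $\ell$-algebras (isomorphisms preserve degrees); it is pointed by the class of $B$. Let $k_1[F]$ be the twisted polynomial ring with $Fa=a^pF$ for $a\in k_1$, and let $k_1[F]^*$ be the multiplicative monoid of its separable elements, i.e. the $\tau=\sum_i a_iF^i$ with $a_0\neq 0$. For $\tau=\sum_{i=0}^m a_iF^i\in k_1[F]^*$ put $$A(\tau)=k[T_1,T_2]/\bigl(T_2^{p^n}-(a_0T_1+a_1T_1^p+\dots+a_mT_1^{p^m})\bigr),$$ graded with $T_1,T_2$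 of degree $1\in\Gamma$. For $\sigma=\sum_i s_iF^i$ put $\sigma^{(n)}=\sum_i s_i^{p^n}F^i$. Let $U_n$ be the image of $k_1[F]^*$ in $k_1[F]/k_1[F]F^n$ (the left ideal $k_1[F]F^n$ is two-sided, and $U_n$ is a group under multiplication), and let $G_n=U_n\times k_1^\times$. Let $V_n$ be the image of $k_1[F]^*$ in the quotient of $k_1[F]$ by the right ideal $F^nk_1[F]=k_1[F]^{(n)}F^n$, pointed by the class of $1$. The group $G_n$ acts on $V_n$ by $$(\bar\sigma,c)\cdot\bar\tau=\overline{\sigma^{(n)}\tau c^{-1}}.$$ Then for every $\tau\in k_1[F]^*$ the graded algebra $A(\tau)$ is a graded form of $B$ with respect to $\ell/k$, and the map $\tau\mapsto[A(\tau)]$ induces an injective map of pointed sets $$V_n/G_n\hookrightarrow H^1(\ell/k,\mathbf{Aut}^{\rm gr}B).$$ -/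

import Mathlib

noncomputable section
namespace RussellForms

/-- The action of `ℕ` on a ring of characteristic exponent `p` by powers of Frobenius. -/
abbrev frobAction (p : ℕ) (R : Type*) [CommRing R] [ExpChar R p] :
    MulSemiringAction (Multiplicative ℕ) R :=
  MulSemiringAction.compHom R (powersHom (R →+* R) (frobenius R p))

/-- The twisted polynomial ring `R[F]`, with `F a = a ^ p F`. -/
def FrobPoly (p : ℕ) (R : Type*) [CommRing R] [ExpChar R p] : Type _ := SkewPolynomial R

namespace FrobPoly

variable {p : ℕ} {R : Type*}

section CommRing

variable [CommRing R] [ExpChar R p]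

instance : Ring (FrobPoly p R) :=
  letI := frobAction p R
  inferInstanceAs (Ring (SkewPolynomial R))

/-- The `i`-th coefficient `a_i` of `∑ a_i F ^ i`. -/
def coeff (τ : FrobPoly p R) (i : ℕ) : R := SkewPolynomial.coeff τ i

/-- The Frobenius endomorphism `F`. -/
def F : FrobPoly p R := (SkewPolynomial.X : SkewPolynomial R)

/-- The inclusion of the constants. -/
def C : R →+* FrobPoly p R :=
  letI := frobAction p R
  (SkewPolynomial.CRingHom : R →+* SkewPolynomial R)

/-- `τ ↦ τ^{(n)}`: raise all coefficients to the power `p ^ n` (underlying function). -/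
def twistFun (n : ℕ) (τ : FrobPoly p R) : FrobPoly p R :=
  SkewPolynomial.sum τ fun i a => (SkewPolynomial.monomial i (a ^ p ^ n) : SkewPolynomial R)

lemma phi_iterate (n : ℕ) (a : R) :
    letI := frobAction p R
    (MulSemiringAction.toRingHom (Multiplicative ℕ) R (Multiplicative.ofAdd 1))^[n] a =
      a ^ p ^ n := by
  let := frobAction p R
  have h : ∀ b : R, MulSemiringAction.toRingHom (Multiplicative ℕ) R (Multiplicative.ofAdd 1) b
      = frobenius R p b := fun b => by
    change ((frobenius R p) ^ 1) b = _
    simp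
  rw [show ⇑(MulSemiringAction.toRingHom (Multiplicative ℕ) R (Multiplicative.ofAdd 1))
    = frobenius R p from funext h, iterate_frobenius]

lemma F_pow_mul (n : ℕ) (τ : FrobPoly p R) : F ^ n * τ = twistFun n τ * F ^ n := by
  let := frobAction p R
  have h := SkewPolynomial.X_pow_mul (R := R) (p := τ) (n := n)
  simp only [phi_iterate] at h
  exact h

lemma F_mul_C (a : R) : (F : FrobPoly p R) * C a = C (a ^ p) * F := by
  let := frobAction p R
  have h := SkewPolynomial.X_mul_monomial (R := R) 0 a
  have h2 := SkewPolynomial.C_mul_X_eq_monomial (R := R) (a := a ^ p)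
  have h3 := phi_iterate (p := p) 1 a
  simp only [pow_one, Function.iterate_one] at h3
  rw [h3, zero_add, ← h2] at h
  exact h

lemma ext {σ τ : FrobPoly p R} (h : ∀ i, coeff σ i = coeff τ i) : σ = τ :=
  SkewPolynomial.ext_iff.2 h

lemma coeff_add (σ τ : FrobPoly p R) (i : ℕ) : coeff (σ + τ) i = coeff σ i + coeff τ i :=
  SkewPolynomial.coeff_add σ τ i

lemma coeff_C_zero (a : R) : coeff (C a : FrobPoly p R) 0 = a := SkewPolynomial.coeff_C_zero

lemma coeff_one_zero : coeff (1 : FrobPoly p R) 0 = 1 := SkewPolynomial.coeff_one_zero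

lemma induction {P : FrobPoly p R → Prop} (τ : FrobPoly p R) (h0 : P 0)
    (hadd : ∀ σ τ, P σ → P τ → P (σ + τ)) (hm : ∀ (i : ℕ) (a : R), P (C a * F ^ i)) : P τ := by
  let := frobAction p R
  refine SkewMonoidAlgebra.induction_on (p := P) τ h0 (fun g a => ?_) (fun f g hf hg => hadd f g hf hg)
  have := SkewPolynomial.C_mul_X_pow_eq_monomial (R := R) (a := a) (n := Multiplicative.toAdd g)
  have h := hm (Multiplicative.toAdd g) a
  exact (congrArg P this).mp h

lemma coeff_C_mul_F_pow (a : R) (j i : ℕ) :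
    coeff (C a * F ^ j : FrobPoly p R) i = if j = i then a else 0 := by
  let := frobAction p R
  have h1 := SkewPolynomial.C_mul_X_pow_eq_monomial (R := R) (a := a) (n := j)
  have h2 := SkewPolynomial.coeff_monomial (R := R) (a := a) (n := j) (m := i)
  rw [← h1] at h2
  exact h2

lemma coeff_mul_F_pow (τ : FrobPoly p R) (n i : ℕ) : coeff (τ * F ^ n) (i + n) = coeff τ i := by
  let := frobAction p R
  refine induction (P := fun τ => coeff (τ * F ^ n) (i + n) = coeff τ i) τ ?_ ?_ ?_
  · rw [zero_mul]; rfl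
  · intro σ τ hs ht
    rw [add_mul, coeff_add, coeff_add, hs, ht]
  · intro j a
    rw [mul_assoc, ← pow_add]
    rw [coeff_C_mul_F_pow, coeff_C_mul_F_pow]
    simp

lemma mul_F_pow_cancel {σ τ : FrobPoly p R} (n : ℕ) (h : σ * F ^ n = τ * F ^ n) : σ = τ :=
  ext fun i => by rw [← coeff_mul_F_pow σ n i, h, coeff_mul_F_pow]

lemma coeff_mul_F_zero (τ : FrobPoly p R) : coeff (τ * F) 0 = 0 := by
  let := frobAction p R
  refine induction (P := fun τ => coeff (τ * F) 0 = 0) τ ?_ ?_ ?_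
  · rw [zero_mul]; rfl
  · intro σ τ hs ht
    rw [add_mul, coeff_add, hs, ht, add_zero]
  · intro j a
    rw [mul_assoc, ← pow_succ]
    rw [coeff_C_mul_F_pow, if_neg (Nat.succ_ne_zero j)]

lemma coeff_mul_F_pow_zero (τ : FrobPoly p R) {n : ℕ} (hn : n ≠ 0) : coeff (τ * F ^ n) 0 = 0 := by
  obtain ⟨m, rfl⟩ := Nat.exists_eq_succ_of_ne_zero hn
  rw [pow_succ, ← mul_assoc, coeff_mul_F_zero]

lemma exists_eq_C_add_mul_F (τ : FrobPoly p R) : ∃ ρ, τ = C (coeff τ 0) + ρ * F := by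
  refine induction (P := fun τ => ∃ ρ, τ = C (coeff τ 0) + ρ * F) τ ?_ ?_ ?_
  · exact ⟨0, by rw [show coeff (0 : FrobPoly p R) 0 = 0 from rfl, map_zero, zero_mul, add_zero]⟩
  · rintro σ τ ⟨a, ha⟩ ⟨b, hb⟩
    refine ⟨a + b, ?_⟩
    rw [coeff_add, map_add, add_mul]
    nth_rw 1 [ha, hb]
    abel
  · intro j a
    rcases j with _ | j
    · exact ⟨0, by rw [pow_zero, mul_one, coeff_C_zero, zero_mul, add_zero]⟩
    · refine ⟨C a * F ^ j, ?_⟩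
      rw [coeff_mul_F_pow_zero _ (Nat.succ_ne_zero j), map_zero, zero_add, pow_succ, mul_assoc]

lemma coeff_mul_zero (σ τ : FrobPoly p R) : coeff (σ * τ) 0 = coeff σ 0 * coeff τ 0 := by
  obtain ⟨a, ha⟩ := exists_eq_C_add_mul_F σ
  obtain ⟨b, hb⟩ := exists_eq_C_add_mul_F τ
  have h := F_pow_mul (p := p) 1 τ
  rw [pow_one] at h
  have : σ * τ = C (coeff σ 0 * coeff τ 0) + (C (coeff σ 0) * b + a * twistFun 1 τ) * F := by
    nth_rw 1 [ha]
    rw [add_mul, mul_assoc a, h]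
    nth_rw 1 [hb]
    rw [mul_add, add_mul, map_mul, mul_assoc, mul_assoc, add_assoc]
  rw [this, coeff_add, coeff_C_zero, coeff_mul_F_zero, add_zero]

/-- `τ ↦ τ^{(n)}`, the extension to `R[F]` of the `n`-th power of Frobenius on `R`. -/
def twist (n : ℕ) : FrobPoly p R →+* FrobPoly p R where
  toFun := twistFun n
  map_one' := mul_F_pow_cancel n (by rw [← F_pow_mul, mul_one, one_mul])
  map_mul' σ τ := mul_F_pow_cancel n (by
    rw [← F_pow_mul, ← mul_assoc, F_pow_mul, mul_assoc, F_pow_mul, mul_assoc])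
  map_zero' := mul_F_pow_cancel n (by rw [← F_pow_mul, mul_zero, zero_mul])
  map_add' σ τ := mul_F_pow_cancel n (by rw [← F_pow_mul, mul_add, add_mul, F_pow_mul, F_pow_mul])

lemma F_pow_mul_eq (n : ℕ) (τ : FrobPoly p R) : F ^ n * τ = twist n τ * F ^ n := F_pow_mul n τ

lemma coeff_twist (n : ℕ) (τ : FrobPoly p R) (i : ℕ) :
    coeff (twist n τ) i = coeff τ i ^ p ^ n := by
  let := frobAction p R
  refine induction (P := fun τ => coeff (twist n τ) i = coeff τ i ^ p ^ n) τ ?_ ?_ ?_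
  · rw [map_zero]
    change (0 : R) = 0 ^ p ^ n
    rw [zero_pow (pow_ne_zero _ (expChar_ne_zero R p))]
  · intro σ τ hs ht
    rw [map_add, coeff_add, coeff_add, hs, ht, add_pow_expChar_pow]
  · intro j a
    have h0 : (0 : R) ^ p ^ n = 0 := zero_pow (pow_ne_zero _ (expChar_ne_zero R p))
    have h1 : twist n (C a * F ^ j : FrobPoly p R) = C (a ^ p ^ n) * F ^ j := by
      have e1 := SkewPolynomial.C_mul_X_pow_eq_monomial (R := R) (a := a) (n := j)
      have e2 := SkewPolynomial.C_mul_X_pow_eq_monomial (R := R) (a := a ^ p ^ n) (n := j)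
      have e3 := SkewPolynomial.sum_monomial_index (n := j) (b := a)
        (h := fun i a => (SkewPolynomial.monomial i (a ^ p ^ n) : SkewPolynomial R))
        (by rw [h0]; simp)
      rw [← e1, ← e2] at e3
      exact e3
    rw [h1, coeff_C_mul_F_pow, coeff_C_mul_F_pow]
    split_ifs <;> simp [h0]

/-- The left ideal `R[F] F ^ n`, which is two-sided. -/
def leftIdeal (p : ℕ) (R : Type*) [CommRing R] [ExpChar R p] (n : ℕ) : Ideal (FrobPoly p R) :=
  Ideal.span {F ^ n}

lemma mem_leftIdeal {n : ℕ} {τ : FrobPoly p R} : τ ∈ leftIdeal p R n ↔ ∃ ρ, ρ * F ^ n = τ :=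
  Ideal.mem_span_singleton'

instance (n : ℕ) : (leftIdeal p R n).IsTwoSided where
  mul_mem_of_left {a} b ha := by
    obtain ⟨c, rfl⟩ := mem_leftIdeal.1 ha
    exact mem_leftIdeal.2 ⟨c * twist n b, by rw [mul_assoc, mul_assoc, F_pow_mul_eq]⟩

/-- The right ideal `F ^ n R[F]`, that is, `R[F]^{(n)} F ^ n`. -/
def rightIdeal (p : ℕ) (R : Type*) [CommRing R] [ExpChar R p] (n : ℕ) :
    AddSubgroup (FrobPoly p R) :=
  (AddMonoidHom.mulLeft (F ^ n : FrobPoly p R)).range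

lemma mem_rightIdeal {n : ℕ} {τ : FrobPoly p R} : τ ∈ rightIdeal p R n ↔ ∃ ρ, F ^ n * ρ = τ :=
  Iff.rfl

/-- `R[F] / R[F] F ^ n` acts on `R[F] / F ^ n R[F]`, the class of `σ` acting by left
multiplication by `σ^{(n)}`. -/
def leftAct (n : ℕ) : (FrobPoly p R ⧸ leftIdeal p R n) →+*
    AddMonoid.End (FrobPoly p R ⧸ rightIdeal p R n) :=
  Ideal.Quotient.lift (leftIdeal p R n)
    { toFun := fun σ => QuotientAddGroup.map _ _ (AddMonoidHom.mulLeft (twist n σ)) (by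
        rintro _ ⟨ρ, rfl⟩
        refine mem_rightIdeal.2 ⟨σ * ρ, ?_⟩
        simp only [AddMonoidHom.coe_mulLeft]
        rw [← mul_assoc, ← mul_assoc, F_pow_mul_eq])
      map_one' := by
        refine AddMonoidHom.ext fun v => ?_
        induction v using QuotientAddGroup.induction_on with
        | H τ => simp; rfl
      map_mul' := fun σ₁ σ₂ => by
        refine AddMonoidHom.ext fun v => ?_
        induction v using QuotientAddGroup.induction_on with
        | H τ => simp [mul_assoc]; rfl
      map_zero' := by
        refine AddMonoidHom.ext fun v => ?_
        induction v using QuotientAddGroup.induction_on with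
        | H τ => simp; rfl
      map_add' := fun σ₁ σ₂ => by
        refine AddMonoidHom.ext fun v => ?_
        induction v using QuotientAddGroup.induction_on with
        | H τ => simp [add_mul]; rfl }
    (fun σ hσ => by
      obtain ⟨ρ, rfl⟩ := mem_leftIdeal.1 hσ
      refine AddMonoidHom.ext fun v => ?_
      induction v using QuotientAddGroup.induction_on with
      | H τ =>
        refine (QuotientAddGroup.eq_zero_iff _).2 (mem_rightIdeal.2 ⟨ρ * τ, ?_⟩)
        have e : twist n (ρ * F ^ n) = F ^ n * ρ :=
          mul_F_pow_cancel n (by rw [← F_pow_mul_eq, mul_assoc])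
        change F ^ n * (ρ * τ) = twist n (ρ * F ^ n) * τ
        rw [e, mul_assoc])

lemma leftAct_mk (n : ℕ) (σ τ : FrobPoly p R) :
    leftAct n (Ideal.Quotient.mk _ σ) (QuotientAddGroup.mk τ) =
      QuotientAddGroup.mk (twist n σ * τ) := rfl

/-- Right multiplication by a constant on `R[F] / F ^ n R[F]`. -/
def rightMul (n : ℕ) (c : R) : AddMonoid.End (FrobPoly p R ⧸ rightIdeal p R n) :=
  QuotientAddGroup.map _ _ (AddMonoidHom.mulRight (C c)) (by
    rintro _ ⟨ρ, rfl⟩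
    exact mem_rightIdeal.2 ⟨ρ * C c, by simp [mul_assoc]⟩)

lemma rightMul_mk (n : ℕ) (c : R) (τ : FrobPoly p R) :
    rightMul n c (QuotientAddGroup.mk τ) = QuotientAddGroup.mk (τ * C c) := rfl

end CommRing

section Field

variable (p) (R) [Field R] [ExpChar R p]

/-- The monoid `R[F]^*` of separable endomorphisms: those with `a_0 ≠ 0`. -/
def sep : Submonoid (FrobPoly p R) where
  carrier := {τ | coeff τ 0 ≠ 0}
  one_mem' := by rw [Set.mem_ofPred_eq, coeff_one_zero]; exact one_ne_zero
  mul_mem' ha hb := by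
    rw [Set.mem_ofPred_eq, coeff_mul_zero]; exact mul_ne_zero ha hb

/-- `U_n`, the image of `R[F]^*` in `R[F] / R[F] F ^ n`. -/
def U (n : ℕ) : Submonoid (FrobPoly p R ⧸ leftIdeal p R n) :=
  (sep p R).map (Ideal.Quotient.mk (leftIdeal p R n))

/-- The image of `R[F]^*` in `R[F] / F ^ n R[F]`. -/
def V (n : ℕ) : Type _ :=
  {v : FrobPoly p R ⧸ rightIdeal p R n // ∃ τ ∈ sep p R, QuotientAddGroup.mk τ = v}

variable {p} {R}

lemma exists_left_inv (n : ℕ) (σ : FrobPoly p R) (hσ : σ ∈ sep p R) :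
    ∃ ρ ∈ sep p R, ∃ h, ρ * σ = 1 + h * F ^ (n + 1) := by
  induction n with
  | zero =>
    obtain ⟨b, hb⟩ := exists_eq_C_add_mul_F σ
    refine ⟨C (coeff σ 0)⁻¹, ?_, C (coeff σ 0)⁻¹ * b, ?_⟩
    · change coeff _ 0 ≠ 0
      rw [coeff_C_zero]
      exact inv_ne_zero hσ
    · nth_rw 2 [hb]
      rw [mul_add, ← map_mul, inv_mul_cancel₀ hσ, map_one, zero_add, pow_one, mul_assoc]
  | succ n ih =>
    obtain ⟨ρ, hρ, h, hh⟩ := ih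
    refine ⟨(1 - h * F ^ (n + 1)) * ρ, Submonoid.mul_mem _ ?_ hρ,
      -(h * twist (n + 1) h * F ^ n), ?_⟩
    · change coeff _ 0 ≠ 0
      rw [sub_eq_add_neg, ← neg_mul, coeff_add, coeff_mul_F_pow_zero _ (Nat.succ_ne_zero n),
        coeff_one_zero, add_zero]
      exact one_ne_zero
    · have e : h * F ^ (n + 1) * (h * F ^ (n + 1)) =
          h * twist (n + 1) h * F ^ n * F ^ (n + 1 + 1) := by
        rw [mul_assoc, ← mul_assoc (F ^ (n + 1)), F_pow_mul_eq]
        simp only [mul_assoc, ← pow_add]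
        rw [show n + 1 + (n + 1) = n + (n + 1 + 1) by omega]
      rw [mul_assoc, hh, neg_mul, ← e]
      noncomm_ring

lemma exists_inv (n : ℕ) (u : U p R n) : ∃ v : U p R n, v * u = 1 := by
  obtain ⟨_, σ, hσ, rfl⟩ := u
  obtain ⟨ρ, hρ, h, hh⟩ := exists_left_inv n σ hσ
  refine ⟨⟨_, ρ, hρ, rfl⟩, Subtype.ext ?_⟩
  change Ideal.Quotient.mk (leftIdeal p R n) ρ * Ideal.Quotient.mk (leftIdeal p R n) σ =
    Ideal.Quotient.mk (leftIdeal p R n) 1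
  rw [← map_mul, hh, Ideal.Quotient.eq]
  exact mem_leftIdeal.2 ⟨h * F, by rw [pow_succ', ← mul_assoc, add_sub_cancel_left]⟩

instance (n : ℕ) : Group (U p R n) :=
  { (inferInstance : Monoid (U p R n)) with
    inv := fun u => (exists_inv n u).choose
    inv_mul_cancel := fun u => (exists_inv n u).choose_spec }

variable (p) (R) in
/-- `G_n = U_n × R^×`. -/
abbrev G (n : ℕ) : Type _ := U p R n × Rˣ

/-- The class of a separable endomorphism in `V_n`. -/
def V.mk (n : ℕ) (τ : sep p R) : V p R n := ⟨QuotientAddGroup.mk τ.1, τ.1, τ.2, rfl⟩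

/-- The class of a separable endomorphism in `U_n`. -/
def U.mk (n : ℕ) (σ : sep p R) : U p R n := ⟨Ideal.Quotient.mk _ σ.1, σ.1, σ.2, rfl⟩

/-- The action `(σ, c) • τ = σ^{(n)} τ c⁻¹` of `G_n` on `V_n`. -/
instance (n : ℕ) : MulAction (G p R n) (V p R n) where
  smul g v := ⟨leftAct n g.1.1 (rightMul n ((g.2⁻¹ : Rˣ) : R) v.1), by
    obtain ⟨⟨_, σ, hσ, rfl⟩, c⟩ := g
    obtain ⟨_, τ, hτ, rfl⟩ := v
    refine ⟨twist n σ * (τ * C ((c⁻¹ : Rˣ) : R)), ?_, rfl⟩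
    change coeff _ 0 ≠ 0
    rw [coeff_mul_zero, coeff_mul_zero, coeff_twist, coeff_C_zero]
    exact mul_ne_zero (pow_ne_zero _ hσ) (mul_ne_zero hτ c⁻¹.ne_zero)⟩
  one_smul v := by
    obtain ⟨_, τ, hτ, rfl⟩ := v
    refine Subtype.ext ?_
    change QuotientAddGroup.mk (twist n 1 * (τ * C ((1⁻¹ : Rˣ) : R))) = _
    simp
  mul_smul g g' v := by
    obtain ⟨⟨_, σ, hσ, rfl⟩, c⟩ := g
    obtain ⟨⟨_, σ', hσ', rfl⟩, c'⟩ := g'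
    obtain ⟨_, τ, hτ, rfl⟩ := v
    refine Subtype.ext ?_
    change QuotientAddGroup.mk (twist n (σ * σ') * (τ * C (((c * c')⁻¹ : Rˣ) : R))) =
      QuotientAddGroup.mk (twist n σ * (twist n σ' * (τ * C ((c'⁻¹ : Rˣ) : R)) *
        C ((c⁻¹ : Rˣ) : R)))
    rw [mul_inv_rev, Units.val_mul, map_mul, map_mul]
    simp only [mul_assoc]

lemma smul_mk (n : ℕ) (σ τ : sep p R) (c : Rˣ) :
    ((U.mk n σ, c) • V.mk n τ).1 =
      QuotientAddGroup.mk (twist n σ.1 * τ.1 * C ((c⁻¹ : Rˣ) : R)) := by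
  change QuotientAddGroup.mk (twist n σ.1 * (τ.1 * C ((c⁻¹ : Rˣ) : R))) = _
  rw [mul_assoc]

end Field

end FrobPoly

/-! ### Graded rings, graded fields, graded algebras -/

/-- A graded field: a nonzero graded ring in which every nonzero homogeneous element is
invertible. -/
class IsGradedField {Γ k : Type*} [CommRing k] (𝒦 : Γ → AddSubgroup k) : Prop where
  nontrivial : Nontrivial k
  isUnit : ∀ {γ : Γ} {a : k}, a ∈ 𝒦 γ → a ≠ 0 → IsUnit a

section DegreeZero

variable {Γ k : Type*} [AddCommGroup Γ] [DecidableEq Γ] [CommRing k] (𝒦 : Γ → AddSubgroup k)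
  [GradedRing 𝒦] [IsGradedField 𝒦]

lemma exists_inv_degree_zero (a : 𝒦 0) (ha : a ≠ 0) : ∃ b : 𝒦 0, a * b = 1 := by
  have h0 : (a : k) ≠ 0 := fun h => ha (Subtype.ext h)
  obtain ⟨y, hy⟩ := (IsGradedField.isUnit a.2 h0).exists_right_inv
  refine ⟨DirectSum.decompose 𝒦 y 0, Subtype.ext ?_⟩
  have h := DirectSum.coe_decompose_mul_of_left_mem_zero 𝒦 (j := 0) (b := y) a.2
  rw [hy, DirectSum.decompose_of_mem_same 𝒦 SetLike.GradedOne.one_mem] at h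
  exact h.symm

open Classical in
/-- The homogeneous part of trivial degree of a graded field is a field. (The index group is
written additively, so this part has index `0`.) -/
instance : Field (𝒦 0) :=
  { (inferInstance : CommRing (𝒦 0)) with
    exists_pair_ne := ⟨0, 1, fun h => by
      have := IsGradedField.nontrivial (𝒦 := 𝒦)
      exact zero_ne_one (α := k) (congrArg Subtype.val h)⟩
    inv := fun a => if h : a = 0 then 0 else (exists_inv_degree_zero 𝒦 a h).choose
    mul_inv_cancel := fun a h => by
      simp only [dif_neg h]
      exact (exists_inv_degree_zero 𝒦 a h).choose_spec
    inv_zero := dif_pos rfl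
    nnqsmul := _
    qsmul := _ }

end DegreeZero

/-- A commutative graded algebra over the graded ring `k`. -/
structure GradedAlg {Γ : Type*} [AddCommGroup Γ] [DecidableEq Γ] {k : Type*} [CommRing k]
    (𝒦 : Γ → AddSubgroup k) where
  carrier : Type*
  [commRing : CommRing carrier]
  [algebra : Algebra k carrier]
  grading : Γ → AddSubgroup carrier
  [gradedRing : GradedRing grading]
  algebraMap_mem : ∀ {γ : Γ} {a : k}, a ∈ 𝒦 γ → algebraMap k carrier a ∈ grading γ

namespace GradedAlg

attribute [instance] GradedAlg.commRing GradedAlg.algebra GradedAlg.gradedRing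

section Basic

variable {Γ : Type*} [AddCommGroup Γ] [DecidableEq Γ] {k : Type*} [CommRing k]
  {𝒦 : Γ → AddSubgroup k}

/-- `A` and `A'` are isomorphic as graded `k`-algebras (by an isomorphism preserving degrees). -/
def Iso (A A' : GradedAlg 𝒦) : Prop :=
  ∃ e : A.carrier ≃ₐ[k] A'.carrier, ∀ γ x, e x ∈ A'.grading γ ↔ x ∈ A.grading γ

lemma Iso.equivalence : Equivalence (Iso (𝒦 := 𝒦)) where
  refl A := ⟨AlgEquiv.refl, fun _ _ => Iff.rfl⟩
  symm := fun ⟨e, he⟩ => ⟨e.symm, fun γ x => by rw [← he, e.apply_symm_apply]⟩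
  trans := fun ⟨e, he⟩ ⟨f, hf⟩ => ⟨e.trans f, fun γ x => by
    rw [AlgEquiv.trans_apply, hf, he]⟩

open scoped TensorProduct in
/-- The tensor product grading on `ℓ ⊗[k] A`: its part of degree `γ` is the sum of the
`ℓ_δ ⊗ A_τ` over all `δ`, `τ` with `δ + τ = γ` (the index group is written additively). -/
def tensorGrading {ℓ : Type*} [CommRing ℓ] [Algebra k ℓ] (𝓛 : Γ → AddSubgroup ℓ)
    (A : GradedAlg 𝒦) (γ : Γ) : AddSubgroup (ℓ ⊗[k] A.carrier) :=
  AddSubgroup.closure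
    {t | ∃ δ τ, δ + τ = γ ∧ ∃ b ∈ 𝓛 δ, ∃ a ∈ A.grading τ, t = b ⊗ₜ[k] a}

open scoped TensorProduct in
/-- `A` is a graded form of `B` with respect to `ℓ / k`: there is an isomorphism of graded
`ℓ`-algebras between `ℓ ⊗[k] A` and `ℓ ⊗[k] B`. -/
def IsForm {ℓ : Type*} [CommRing ℓ] [Algebra k ℓ] (𝓛 : Γ → AddSubgroup ℓ)
    (B A : GradedAlg 𝒦) : Prop :=
  ∃ e : (ℓ ⊗[k] A.carrier) ≃ₐ[ℓ] (ℓ ⊗[k] B.carrier),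
    ∀ γ x, e x ∈ tensorGrading 𝓛 B γ ↔ x ∈ tensorGrading 𝓛 A γ

lemma IsForm.refl {ℓ : Type*} [CommRing ℓ] [Algebra k ℓ] (𝓛 : Γ → AddSubgroup ℓ)
    (B : GradedAlg 𝒦) : IsForm 𝓛 B B := ⟨AlgEquiv.refl, fun _ _ => Iff.rfl⟩

/-- Graded isomorphism, on the graded forms of `B` with respect to `ℓ / k`. -/
instance formSetoid {ℓ : Type*} [CommRing ℓ] [Algebra k ℓ] (𝓛 : Γ → AddSubgroup ℓ)
    (B : GradedAlg 𝒦) : Setoid {A : GradedAlg 𝒦 // IsForm 𝓛 B A} where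
  r A A' := Iso A.1 A'.1
  iseqv := ⟨fun A => Iso.equivalence.refl A.1, fun h => Iso.equivalence.symm h,
    fun h h' => Iso.equivalence.trans h h'⟩

/-- `H^1(ℓ / k, Aut^gr B)`: the set of isomorphism classes of graded forms of `B` with respect
to `ℓ / k`. -/
def H1 {ℓ : Type*} [CommRing ℓ] [Algebra k ℓ] (𝓛 : Γ → AddSubgroup ℓ)
    (B : GradedAlg 𝒦) : Type _ := Quotient (formSetoid 𝓛 B)

/-- The class of a form. -/
def H1.mk {ℓ : Type*} [CommRing ℓ] [Algebra k ℓ] (𝓛 : Γ → AddSubgroup ℓ)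
    (B A : GradedAlg 𝒦) (hA : IsForm 𝓛 B A) : H1 𝓛 B := Quotient.mk _ ⟨A, hA⟩

/-- The distinguished element of `H^1(ℓ / k, Aut^gr B)`: the class of `B` itself. -/
def H1.base {ℓ : Type*} [CommRing ℓ] [Algebra k ℓ] (𝓛 : Γ → AddSubgroup ℓ)
    (B : GradedAlg 𝒦) : H1 𝓛 B := H1.mk 𝓛 B B (IsForm.refl 𝓛 B)

/-- The quotient grading. -/
def quotGrading (A : GradedAlg 𝒦) (I : Ideal A.carrier) (γ : Γ) :
    AddSubgroup (A.carrier ⧸ I) :=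
  (A.grading γ).map (Ideal.Quotient.mk I).toAddMonoidHom

lemma mk_mem_quotGrading (A : GradedAlg 𝒦) (I : Ideal A.carrier) {γ : Γ} {a : A.carrier}
    (ha : a ∈ A.grading γ) : Ideal.Quotient.mk I a ∈ quotGrading A I γ := ⟨a, ha, rfl⟩

instance (A : GradedAlg 𝒦) (I : Ideal A.carrier) : SetLike.GradedMonoid (quotGrading A I) where
  one_mem := mk_mem_quotGrading A I SetLike.GradedOne.one_mem
  mul_mem := by
    rintro i j _ _ ⟨a, ha, rfl⟩ ⟨b, hb, rfl⟩
    exact mk_mem_quotGrading A I (SetLike.GradedMul.mul_mem ha hb)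

/-- The decomposition into homogeneous components, composed with the quotient map. -/
def preDecompose (A : GradedAlg 𝒦) (I : Ideal A.carrier) :
    A.carrier →+ DirectSum Γ fun γ => quotGrading A I γ :=
  (DirectSum.map fun γ => (((Ideal.Quotient.mk I).toAddMonoidHom.comp
    (A.grading γ).subtype).codRestrict (quotGrading A I γ)
      fun a => mk_mem_quotGrading A I a.2)).comp
    (DirectSum.decomposeAddEquiv A.grading).toAddMonoidHom

lemma preDecompose_of_mem (A : GradedAlg 𝒦) (I : Ideal A.carrier) {γ : Γ} {a : A.carrier}
    (ha : a ∈ A.grading γ) : preDecompose A I a =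
      DirectSum.of (fun γ => quotGrading A I γ) γ ⟨_, mk_mem_quotGrading A I ha⟩ := by
  change DirectSum.map _ (DirectSum.decompose A.grading a) = _
  rw [DirectSum.decompose_of_mem _ ha, DirectSum.map_of]
  rfl

/-- The decomposition of the quotient by a homogeneous ideal. -/
def quotDecompose (A : GradedAlg 𝒦) (I : Ideal A.carrier) (hI : I.IsHomogeneous A.grading) :
    A.carrier ⧸ I →+ DirectSum Γ fun γ => quotGrading A I γ :=
  QuotientAddGroup.lift I.toAddSubgroup (preDecompose A I) fun x hx => by
    refine DFinsupp.ext fun γ => Subtype.ext ?_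
    change Ideal.Quotient.mk I (DirectSum.decompose A.grading x γ) = 0
    exact Ideal.Quotient.eq_zero_iff_mem.2 (hI γ hx)

lemma quotDecompose_mk (A : GradedAlg 𝒦) (I : Ideal A.carrier) (hI : I.IsHomogeneous A.grading)
    (a : A.carrier) : quotDecompose A I hI (Ideal.Quotient.mk I a) = preDecompose A I a := rfl

/-- The quotient of a graded ring by a homogeneous ideal is a graded ring. -/
abbrev quotGradedRing (A : GradedAlg 𝒦) (I : Ideal A.carrier)
    (hI : I.IsHomogeneous A.grading) : GradedRing (quotGrading A I) :=
  { (inferInstance : SetLike.GradedMonoid (quotGrading A I)),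
    DirectSum.Decomposition.ofAddHom (quotGrading A I) (quotDecompose A I hI)
      (by
        refine AddMonoidHom.ext fun x => ?_
        obtain ⟨x, rfl⟩ := Ideal.Quotient.mk_surjective x
        rw [AddMonoidHom.comp_apply, quotDecompose_mk, AddMonoidHom.id_apply]
        induction x using DirectSum.Decomposition.inductionOn A.grading with
        | zero => rw [map_zero, map_zero, map_zero]
        | homogeneous m =>
          rw [preDecompose_of_mem A I m.2, DirectSum.coeAddMonoidHom_of]
        | add m m' h h' => rw [map_add, map_add, h, h', map_add])
      (by
        refine DirectSum.addHom_ext fun γ y => ?_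
        obtain ⟨_, a, ha, rfl⟩ := y
        rw [AddMonoidHom.comp_apply, DirectSum.coeAddMonoidHom_of]
        exact preDecompose_of_mem A I ha) with }

/-- The quotient of a graded algebra by a homogeneous ideal, with the quotient grading. -/
def quot (A : GradedAlg 𝒦) (I : Ideal A.carrier) (hI : I.IsHomogeneous A.grading) :
    GradedAlg 𝒦 where
  carrier := A.carrier ⧸ I
  grading := quotGrading A I
  gradedRing := quotGradedRing A I hI
  algebraMap_mem ha := mk_mem_quotGrading A I (A.algebraMap_mem ha)

end Basic

section Poly

set_option linter.unusedSectionVars false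

variable {Γ : Type*} [AddCommGroup Γ] [DecidableEq Γ] {k : Type*} [CommRing k]

/-- The grading of the polynomial ring in which the variable `T_i` has degree `r i`: a polynomial
is homogeneous of degree `γ` if the coefficient of `T^I` lies in degree `γ - ∑ I_i r_i` for all
`I`. -/
def polyGrading (𝒦 : Γ → AddSubgroup k) {σ : Type*} (r : σ → Γ) (γ : Γ) :
    AddSubgroup (MvPolynomial σ k) where
  carrier := {f | ∀ I : σ →₀ ℕ, f.coeff I ∈ 𝒦 (γ - Finsupp.weight r I)}
  zero_mem' I := by rw [MvPolynomial.coeff_zero]; exact zero_mem _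
  add_mem' hf hg I := by rw [MvPolynomial.coeff_add]; exact add_mem (hf I) (hg I)
  neg_mem' hf I := by rw [MvPolynomial.coeff_neg]; exact neg_mem (hf I)

variable (𝒦 : Γ → AddSubgroup k) {σ : Type*} (r : σ → Γ)

lemma monomial_mem_polyGrading {γ : Γ} {I : σ →₀ ℕ} {a : k} (ha : a ∈ 𝒦 γ) :
    MvPolynomial.monomial I a ∈ polyGrading 𝒦 r (γ + Finsupp.weight r I) := by
  classical
  intro J
  rw [MvPolynomial.coeff_monomial]
  split_ifs with h
  · subst h; rwa [add_sub_cancel_right]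
  · exact zero_mem _

variable [GradedRing 𝒦]

instance : SetLike.GradedMonoid (polyGrading 𝒦 r) where
  one_mem := by
    have h := monomial_mem_polyGrading 𝒦 r (I := 0) (SetLike.GradedOne.one_mem (A := 𝒦))
    rwa [map_zero, add_zero] at h
  mul_mem := by
    classical
    intro i j f g hf hg I
    rw [MvPolynomial.coeff_mul]
    refine sum_mem fun x hx => ?_
    have h := SetLike.GradedMul.mul_mem (hf x.1) (hg x.2)
    rwa [sub_add_sub_comm, ← map_add, Finset.HasAntidiagonal.mem_antidiagonal.1 hx] at h

/-- The decomposition of a monomial with arbitrary coefficient. -/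
def polyDecomposeMonomial (I : σ →₀ ℕ) :
    k →+ DirectSum Γ fun γ => polyGrading 𝒦 r γ :=
  (DirectSum.toAddMonoid fun γ =>
    (DirectSum.of (fun γ => polyGrading 𝒦 r γ) (γ + Finsupp.weight r I)).comp
      (((MvPolynomial.monomial I).toAddMonoidHom.comp (𝒦 γ).subtype).codRestrict
        (polyGrading 𝒦 r (γ + Finsupp.weight r I))
        fun a => monomial_mem_polyGrading 𝒦 r a.2)).comp
    (DirectSum.decomposeAddEquiv 𝒦).toAddMonoidHom

lemma polyDecomposeMonomial_of_mem {I : σ →₀ ℕ} {γ : Γ} {a : k}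
    (ha : a ∈ 𝒦 (γ - Finsupp.weight r I)) (h : MvPolynomial.monomial I a ∈ polyGrading 𝒦 r γ) :
    polyDecomposeMonomial 𝒦 r I a = DirectSum.of (fun γ => polyGrading 𝒦 r γ) γ ⟨_, h⟩ := by
  change DirectSum.toAddMonoid _ (DirectSum.decompose 𝒦 a) = _
  rw [DirectSum.decompose_of_mem _ ha, DirectSum.toAddMonoid_of]
  refine DirectSum.of_eq_of_gradedMonoid_eq (Sigma.subtype_ext ?_ rfl)
  exact sub_add_cancel _ _

/-- The decomposition of a polynomial. -/
def polyDecompose : MvPolynomial σ k →+ DirectSum Γ fun γ => polyGrading 𝒦 r γ :=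
  (Finsupp.liftAddHom (polyDecomposeMonomial 𝒦 r)).comp
    (AddMonoidAlgebra.coeffAddEquiv (R := k) (M := σ →₀ ℕ)).toAddMonoidHom

lemma polyDecompose_monomial (I : σ →₀ ℕ) (a : k) :
    polyDecompose 𝒦 r (MvPolynomial.monomial I a) = polyDecomposeMonomial 𝒦 r I a :=
  Finsupp.liftAddHom_apply_single _ _ _

lemma monomial_coeff_mem {γ : Γ} {f : MvPolynomial σ k} (hf : f ∈ polyGrading 𝒦 r γ)
    (I : σ →₀ ℕ) : MvPolynomial.monomial I (f.coeff I) ∈ polyGrading 𝒦 r γ := by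
  have h := monomial_mem_polyGrading 𝒦 r (I := I) (hf I)
  rwa [sub_add_cancel] at h

lemma polyDecompose_of_mem {γ : Γ} {f : MvPolynomial σ k} (hf : f ∈ polyGrading 𝒦 r γ) :
    polyDecompose 𝒦 r f = DirectSum.of (fun γ => polyGrading 𝒦 r γ) γ ⟨f, hf⟩ := by
  have h : (⟨f, hf⟩ : polyGrading 𝒦 r γ) =
      ∑ I ∈ f.support, ⟨_, monomial_coeff_mem 𝒦 r hf I⟩ := by
    refine Subtype.ext ?_
    rw [AddSubgroup.val_finsetSum]
    exact f.as_sum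
  rw [h, map_sum]
  conv_lhs => rw [f.as_sum, map_sum]
  refine Finset.sum_congr rfl fun I _ => ?_
  rw [polyDecompose_monomial, polyDecomposeMonomial_of_mem 𝒦 r (hf I)]

instance : DirectSum.Decomposition (polyGrading 𝒦 r) :=
  DirectSum.Decomposition.ofAddHom _ (polyDecompose 𝒦 r)
    (by
      refine AddMonoidHom.ext fun f => ?_
      rw [AddMonoidHom.comp_apply, AddMonoidHom.id_apply]
      induction f using MvPolynomial.induction_on' with
      | monomial I a =>
        rw [polyDecompose_monomial]
        induction a using DirectSum.Decomposition.inductionOn 𝒦 with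
        | zero => rw [map_zero, map_zero, map_zero]
        | homogeneous m =>
          have hm := monomial_mem_polyGrading 𝒦 r (I := I) m.2
          rw [polyDecomposeMonomial_of_mem 𝒦 r (by rw [add_sub_cancel_right]; exact m.2) hm,
            DirectSum.coeAddMonoidHom_of]
        | add m m' h h' => rw [map_add, map_add, h, h', map_add]
      | add f g hf hg => rw [map_add, map_add, hf, hg])
    (by
      refine DirectSum.addHom_ext fun γ f => ?_
      rw [AddMonoidHom.comp_apply, DirectSum.coeAddMonoidHom_of]
      exact polyDecompose_of_mem 𝒦 r f.2)

instance : GradedRing (polyGrading 𝒦 r) where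

/-- The graded `k`-algebra `k[r_i^{-1} T_i]`: the polynomial ring, with `T_i` of degree `r i`. -/
def poly : GradedAlg 𝒦 where
  carrier := MvPolynomial σ k
  grading := polyGrading 𝒦 r
  algebraMap_mem ha := by
    have h := monomial_mem_polyGrading 𝒦 r (I := 0) ha
    rwa [map_zero, add_zero] at h

end Poly

end GradedAlg

/-- `𝒦bar` is a graded algebraic closure of the graded field `k`: it is a graded extension field
all of whose homogeneous elements are algebraic over `k`, and every homogeneous element of positive
monomial degree of a graded polynomial ring `K[r^{-1} T]` has a root which is homogeneous of
degree `r`. -/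
structure IsGradedAlgClosure {Γ : Type*} [AddCommGroup Γ] {k K : Type*} [CommRing k] [CommRing K]
    [Algebra k K] (𝒦 : Γ → AddSubgroup k) (𝒦bar : Γ → AddSubgroup K) : Prop where
  isGradedField : IsGradedField 𝒦bar
  algebraMap_mem : ∀ {γ : Γ} {a : k}, a ∈ 𝒦 γ → algebraMap k K a ∈ 𝒦bar γ
  isAlgebraic : ∀ {γ : Γ} {x : K}, x ∈ 𝒦bar γ → IsAlgebraic k x
  exists_root : ∀ (r s : Γ) (f : Polynomial K), (∀ i : ℕ, f.coeff i ∈ 𝒦bar (s - i • r)) →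
    0 < f.natDegree → ∃ x ∈ 𝒦bar r, f.IsRoot x

/-- The subring `k^{p^{-n}} = {a : a ^ (p ^ n) ∈ k}` of an extension `K` of `k`. -/
def rootExt (p : ℕ) [Fact p.Prime] (k K : Type*) [CommRing k] [CharP k p] [CommRing K]
    [Algebra k K] (n : ℕ) : Subalgebra k K where
  carrier := {a | a ^ p ^ n ∈ (algebraMap k K).range}
  mul_mem' {a b} ha hb := by
    rw [Set.mem_ofPred_eq, mul_pow]; exact mul_mem ha hb
  add_mem' {a b} ha hb := by
    rw [Set.mem_ofPred_eq]
    rcases subsingleton_or_nontrivial K with h | h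
    · exact ⟨0, Subsingleton.elim _ _⟩
    · have : CharP K p := (CharP.charP_iff_prime_eq_zero Fact.out).2 (by
        rw [← map_natCast (algebraMap k K), CharP.cast_eq_zero, map_zero])
      rw [add_pow_char_pow]
      exact add_mem ha hb
  algebraMap_mem' a := ⟨a ^ p ^ n, map_pow _ _ _⟩

/-- The grading of `k^{p^{-n}}` induced from that of `K`. -/
def rootGrading (p : ℕ) [Fact p.Prime] (k : Type*) {Γ K : Type*} [CommRing k] [CharP k p] [CommRing K]
    [Algebra k K] (𝒦bar : Γ → AddSubgroup K) (n : ℕ) (γ : Γ) : AddSubgroup (rootExt p k K n) :=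
  (𝒦bar γ).comap (rootExt p k K n).val.toAddMonoidHom

section Russell

variable {Γ : Type*} [AddCommGroup Γ] [DecidableEq Γ] {k : Type*} [CommRing k]
  (𝒦 : Γ → AddSubgroup k) [GradedRing 𝒦]

instance (p : ℕ) [CharP k p] : CharP (𝒦 0) p where
  cast_eq_zero_iff m := by
    rw [← CharP.cast_eq_zero_iff k p m, Subtype.ext_iff]
    exact Iff.rfl

/-- The `p`-polynomial `a_0 x + a_1 x ^ p + ... + a_m x ^ (p ^ m)` of `τ = ∑ a_i F ^ i` in `k_1[F]`,
evaluated at an element `x` of a `k`-algebra. -/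
def pPoly {p : ℕ} [ExpChar (𝒦 0) p] (τ : FrobPoly p (𝒦 0)) {A : Type*} [CommRing A]
    [Algebra k A] (x : A) : A :=
  SkewPolynomial.sum τ fun i a => algebraMap k A (a : k) * x ^ p ^ i

/-- The graded algebra `k[T]` with `T` of trivial degree (that is, `r = 1`). -/
def discAlg : GradedAlg 𝒦 := GradedAlg.poly 𝒦 fun _ : Unit => 0

/-- The graded algebra `k[T_1, T_2]` with `T_1`, `T_2` of trivial degree. The variables `T_1`, `T_2`
are `X 0`, `X 1`. -/
def planeAlg : GradedAlg 𝒦 := GradedAlg.poly 𝒦 fun _ : Fin 2 => 0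

/-- The ideal `(T_2 ^ (p ^ n) - f(T_1))` of `k[T_1, T_2]`, where `f` is the `p`-polynomial of `τ`. -/
def russellIdeal {p : ℕ} [ExpChar (𝒦 0) p] (n : ℕ) (τ : FrobPoly p (𝒦 0)) :
    Ideal (planeAlg 𝒦).carrier :=
  Ideal.span {(MvPolynomial.X 1 ^ p ^ n - pPoly 𝒦 τ (MvPolynomial.X 0) : MvPolynomial (Fin 2) k)}

lemma X_mem_degree_zero (i : Fin 2) :
    (MvPolynomial.X i : MvPolynomial (Fin 2) k) ∈ (planeAlg 𝒦).grading 0 := by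
  have h := GradedAlg.monomial_mem_polyGrading 𝒦 (fun _ : Fin 2 => (0 : Γ))
    (I := Finsupp.single i 1) (SetLike.GradedOne.one_mem (A := 𝒦))
  rw [Finsupp.weight_single, smul_zero, add_zero] at h
  exact h

lemma X_pow_mem_degree_zero (i : Fin 2) (m : ℕ) :
    (MvPolynomial.X i ^ m : MvPolynomial (Fin 2) k) ∈ (planeAlg 𝒦).grading 0 := by
  have h := SetLike.pow_mem_graded (A := GradedAlg.polyGrading 𝒦 fun _ : Fin 2 => (0 : Γ)) m
    (X_mem_degree_zero 𝒦 i)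
  rw [smul_zero] at h
  exact h

lemma russellIdeal_isHomogeneous {p : ℕ} [ExpChar (𝒦 0) p] (n : ℕ) (τ : FrobPoly p (𝒦 0)) :
    (russellIdeal 𝒦 n τ).IsHomogeneous (planeAlg 𝒦).grading := by
  refine Ideal.homogeneous_span _ _ ?_
  rintro _ rfl
  refine ⟨0, sub_mem (X_pow_mem_degree_zero 𝒦 1 _) (sum_mem fun i _ => ?_)⟩
  have h := SetLike.GradedMul.mul_mem
    ((planeAlg 𝒦).algebraMap_mem (SkewMonoidAlgebra.coeff τ i).2)
    (X_pow_mem_degree_zero 𝒦 0 (p ^ Multiplicative.toAdd i))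
  rw [add_zero] at h
  exact h

/-- `A(τ) = k[T_1, T_2] / (T_2 ^ (p ^ n) - f(T_1))` as a graded `k`-algebra, where `f` is the
`p`-polynomial of `τ`. -/
def russellAlg {p : ℕ} [ExpChar (𝒦 0) p] (n : ℕ) (τ : FrobPoly p (𝒦 0)) : GradedAlg 𝒦 :=
  GradedAlg.quot (planeAlg 𝒦) (russellIdeal 𝒦 n τ) (russellIdeal_isHomogeneous 𝒦 n τ)

end Russell

end RussellForms

end

/-! Write R = k_1 and q = p^n, and let E be the field of elements of trivial degree in the graded
closure whose q-th power comes from R. Every τ in R[F] then has the form b^{(n)} with b in E[F]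
(`exists_rootField`). If τ is separable, so is b, and b is invertible modulo E[F]F^n: ρb = 1 + hF^n
(`exists_inverse_mod`). In any E-algebra the solutions of y^q = τ(x) are therefore parametrised by t
↦ (t^q, b(t)), with inverse (x, y) ↦ ρ(y) - h(x). Applied to the generators, this identifies ℓ ⊗
A(τ) with ℓ[T], so A(τ) is a form (`isForm_russellAlg`).

It remains to see that τ and τ' lie in one orbit exactly when A(τ') and A(τ) are isomorphic; this
gives well-definedness and injectivity together. Being in one orbit means τ'c = σ^{(n)}τ + F^nρ with
σ separable and c a unit (`V.mk_mem_orbit_iff`). Such a relation yields the isomorphism x' ↦ cx, y'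
↦ σ(y) + ρ(x) (`russellAlg_iso`).

Conversely, let an isomorphism send the generators of A(τ') to u and v, viewed in E[T] through x ↦
T^q, y ↦ b(T) (`exists_of_russellAlg_iso`). From v^q = τ'(u) one gets w with u = w^q and v = b'(w),
where b'^{(n)} = τ'. The inverse isomorphism makes T a polynomial in w, so w = cT + d, and v =
b'(cT) + b'(d) lies in R[T^q, b(T)]. The decisive fact is that the additive polynomials in this
subring are those of R[F]b + R[F]F^n (`exists_eq_map_mul_add`). It is proved by differentiation: T^q
has derivative zero (if n > 0) and b(T) has the nonzero constant derivative b_0. Hence b'c = σb +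
ρF^n, and raising all coefficients to the power q gives the relation for the orbit
(`exists_twist_mul_add`). -/

noncomputable section

namespace RussellForms
namespace FrobPoly

/-! ### Homomorphisms out of the twisted polynomial ring. -/

section Additive

variable {p : ℕ} {R S : Type*} [CommRing R] [ExpChar R p]

/-- The additive map `∑ a_i F ^ i ↦ ∑ g_i(a_i)`. -/
def liftAddHom [AddCommMonoid S] (g : ℕ → R →+ S) : FrobPoly p R →+ S where
  toFun τ := SkewPolynomial.sum τ fun i a => g i a
  map_zero' := SkewPolynomial.sum_zero_index _
  map_add' σ τ := SkewPolynomial.sum_add_index σ τ _ (fun i => map_zero (g i)) fun i => map_add (g i)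

lemma liftAddHom_C_mul_F_pow [AddCommMonoid S] (g : ℕ → R →+ S) (i : ℕ) (a : R) :
    liftAddHom g (C a * F ^ i : FrobPoly p R) = g i a := by
  let := frobAction p R
  have e1 := SkewPolynomial.C_mul_X_pow_eq_monomial (R := R) (a := a) (n := i)
  have e2 := SkewPolynomial.sum_monomial_index (n := i) (b := a)
    (h := fun i a => g i a) (map_zero (g i))
  rw [← e1] at e2
  exact e2

lemma twist_C_mul_F_pow (n i : ℕ) (a : R) :
    twist n (C a * F ^ i : FrobPoly p R) = C (a ^ p ^ n) * F ^ i := by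
  refine ext fun l => ?_
  rw [coeff_twist, coeff_C_mul_F_pow, coeff_C_mul_F_pow]
  split_ifs
  · rfl
  · exact zero_pow (pow_ne_zero _ (expChar_ne_zero R p))

lemma monomial_mul_monomial (a b : R) (i l : ℕ) :
    (C a * F ^ i : FrobPoly p R) * (C b * F ^ l) = C (a * b ^ p ^ i) * F ^ (i + l) := by
  have h := twist_C_mul_F_pow (p := p) i 0 b
  rw [pow_zero, mul_one, mul_one] at h
  rw [mul_assoc, ← mul_assoc (F ^ i), F_pow_mul_eq, h, map_mul, pow_add]
  simp only [mul_assoc]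

/-- The ring homomorphism `∑ a_i F ^ i ↦ ∑ g_i(a_i)`. -/
def liftRingHom [Ring S] (g : ℕ → R →+ S) (h1 : g 0 1 = 1)
    (hm : ∀ i l a b, g (i + l) (a * b ^ p ^ i) = g i a * g l b) : FrobPoly p R →+* S :=
  { liftAddHom g with
    map_one' := by
      have h := liftAddHom_C_mul_F_pow (p := p) g 0 1
      rw [map_one, pow_zero, mul_one] at h
      exact h.trans h1
    map_mul' := fun σ τ => by
      change liftAddHom g (σ * τ) = liftAddHom g σ * liftAddHom g τ
      refine induction (P := fun σ => liftAddHom g (σ * τ) = liftAddHom g σ * liftAddHom g τ) σ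
        ?_ ?_ ?_
      · rw [zero_mul, map_zero, zero_mul]
      · intro σ σ' h h'
        rw [add_mul, map_add, map_add, add_mul, h, h']
      · intro i a
        refine induction (P := fun τ => liftAddHom g (C a * F ^ i * τ) =
          liftAddHom g (C a * F ^ i : FrobPoly p R) * liftAddHom g τ) τ ?_ ?_ ?_
        · rw [mul_zero, map_zero, mul_zero]
        · intro σ σ' h h'
          rw [mul_add, map_add, map_add, mul_add, h, h']
        · intro l b
          rw [monomial_mul_monomial, liftAddHom_C_mul_F_pow, liftAddHom_C_mul_F_pow,
            liftAddHom_C_mul_F_pow, hm] }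

lemma exists_coeff_eq_zero (τ : FrobPoly p R) : ∃ N, ∀ i, N ≤ i → coeff τ i = 0 := by
  refine induction (P := fun τ => ∃ N, ∀ i, N ≤ i → coeff τ i = 0) τ ⟨0, fun _ _ => rfl⟩ ?_ ?_
  · rintro σ τ ⟨M, hM⟩ ⟨N, hN⟩
    exact ⟨max M N, fun i hi => by
      rw [coeff_add, hM i (le_of_max_le_left hi), hN i (le_of_max_le_right hi), add_zero]⟩
  · intro j a
    exact ⟨j + 1, fun i hi => by rw [coeff_C_mul_F_pow, if_neg (by omega)]⟩

lemma coeff_sum {ι : Type*} (s : Finset ι) (g : ι → FrobPoly p R) (i : ℕ) :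
    coeff (∑ x ∈ s, g x) i = ∑ x ∈ s, coeff (g x) i :=
  map_sum (AddMonoidHom.mk' (fun τ : FrobPoly p R => coeff τ i) fun σ τ => coeff_add σ τ i) g s

lemma exists_coeff_eq (c : ℕ → R) (N : ℕ) (hc : ∀ i, N ≤ i → c i = 0) :
    ∃ τ : FrobPoly p R, ∀ i, coeff τ i = c i := by
  refine ⟨∑ j ∈ Finset.range N, C (c j) * F ^ j, fun i => ?_⟩
  rw [coeff_sum]
  simp only [coeff_C_mul_F_pow, Finset.sum_ite_eq', Finset.mem_range]
  split_ifs with h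
  · rfl
  · exact (hc i (not_lt.1 h)).symm

end Additive

/-! ### Change of coefficients. -/

section Map

variable {p : ℕ} {R S : Type*} [CommRing R] [ExpChar R p] [CommRing S] [ExpChar S p]

/-- Apply a ring homomorphism to all coefficients. -/
def map (j : R →+* S) : FrobPoly p R →+* FrobPoly p S :=
  liftRingHom (fun i => (AddMonoidHom.mulRight (F ^ i)).comp (C.comp j).toAddMonoidHom)
    (by
      change C (j 1) * F ^ 0 = _
      rw [map_one, map_one, pow_zero, mul_one])
    fun i l a b => by
      change C (j _) * F ^ _ = C (j a) * F ^ i * (C (j b) * F ^ l)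
      rw [monomial_mul_monomial, map_mul, map_pow]

lemma map_C_mul_F_pow (j : R →+* S) (i : ℕ) (a : R) :
    map j (C a * F ^ i : FrobPoly p R) = C (j a) * F ^ i :=
  liftAddHom_C_mul_F_pow (fun i => (AddMonoidHom.mulRight (F ^ i)).comp (C.comp j).toAddMonoidHom) i a

lemma map_C (j : R →+* S) (a : R) : map j (C a : FrobPoly p R) = C (j a) := by
  simpa using map_C_mul_F_pow (p := p) j 0 a

lemma map_F (j : R →+* S) : map j (F : FrobPoly p R) = F := by
  simpa using map_C_mul_F_pow (p := p) j 1 1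

lemma coeff_map (j : R →+* S) (τ : FrobPoly p R) (i : ℕ) : coeff (map j τ) i = j (coeff τ i) := by
  refine induction (P := fun τ => coeff (map j τ) i = j (coeff τ i)) τ ?_ ?_ ?_
  · rw [map_zero]; exact (map_zero j).symm
  · intro σ τ h h'
    rw [map_add, coeff_add, coeff_add, map_add, h, h']
  · intro l a
    rw [map_C_mul_F_pow, coeff_C_mul_F_pow, coeff_C_mul_F_pow]
    split_ifs
    · rfl
    · exact (map_zero j).symm

lemma map_injective {j : R →+* S} (hj : Function.Injective j) :
    Function.Injective (map j : FrobPoly p R → FrobPoly p S) := fun σ τ h =>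
  ext fun i => hj (by rw [← coeff_map, h, coeff_map])

lemma map_twist (j : R →+* S) (n : ℕ) (τ : FrobPoly p R) : map j (twist n τ) = twist n (map j τ) :=
  ext fun i => by rw [coeff_map, coeff_twist, coeff_twist, coeff_map, map_pow]

lemma twist_F_pow (n m : ℕ) : twist n (F ^ m : FrobPoly p R) = F ^ m := by
  simpa using twist_C_mul_F_pow (p := p) n m (1 : R)

lemma twist_C (n : ℕ) (a : R) : twist n (C a : FrobPoly p R) = C (a ^ p ^ n) := by
  simpa using twist_C_mul_F_pow (p := p) n 0 a

end Map

/-! ### Twisted polynomials as additive operators on algebras. -/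

section Act

variable {p : ℕ} [Fact p.Prime] {R A B : Type*} [CommRing R] [CharP R p] [CommRing A] [CommRing B]

/-- The homomorphism from R forces A to have characteristic p or to be zero, so the action below
needs no characteristic assumption on A. -/
lemma add_pow_char_pow_of_ringHom (f : R →+* A) (i : ℕ) (x y : A) :
    (x + y) ^ p ^ i = x ^ p ^ i + y ^ p ^ i := by
  rcases subsingleton_or_nontrivial A with h | h
  · exact Subsingleton.elim _ _
  · have : CharP A p := (CharP.charP_iff_prime_eq_zero Fact.out).2 (by
      rw [← map_natCast f, CharP.cast_eq_zero, map_zero])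
    exact add_pow_char_pow x y p i

/-- The endomorphism `x ↦ a x ^ (p ^ i)` of the additive group of an `R`-algebra `A`. -/
def monomialAct (f : R →+* A) (i : ℕ) : R →+ AddMonoid.End A :=
  AddMonoidHom.mk' (fun a => AddMonoidHom.mk' (fun x => f a * x ^ p ^ i) fun x y => by
    rw [add_pow_char_pow_of_ringHom f, mul_add]) fun a b => by
      refine AddMonoidHom.ext fun x => ?_
      change f (a + b) * x ^ p ^ i = f a * x ^ p ^ i + f b * x ^ p ^ i
      rw [map_add, add_mul]

/-- The action of `R[F]` on an `R`-algebra `A`, with `F` acting as Frobenius. -/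
def act (f : R →+* A) : FrobPoly p R →+* AddMonoid.End A :=
  liftRingHom (monomialAct f)
    (AddMonoidHom.ext fun x => by
      change f 1 * x ^ p ^ 0 = x
      rw [map_one, pow_zero, pow_one, one_mul])
    fun i l a b => AddMonoidHom.ext fun x => by
      change f (a * b ^ p ^ i) * x ^ p ^ (i + l) = f a * (f b * x ^ p ^ l) ^ p ^ i
      rw [mul_pow, map_mul, map_pow, ← pow_mul, ← pow_add, add_comm l, mul_assoc]

lemma act_C_mul_F_pow (f : R →+* A) (i : ℕ) (a : R) (x : A) :
    act f (C a * F ^ i : FrobPoly p R) x = f a * x ^ p ^ i :=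
  DFunLike.congr_fun (liftAddHom_C_mul_F_pow (p := p) (monomialAct (p := p) f) i a) x

lemma act_mul (f : R →+* A) (σ τ : FrobPoly p R) (x : A) :
    act f (σ * τ) x = act f σ (act f τ x) := by rw [map_mul]; rfl

lemma act_add (f : R →+* A) (σ τ : FrobPoly p R) (x : A) :
    act f (σ + τ) x = act f σ x + act f τ x := by rw [map_add]; rfl

lemma act_one (f : R →+* A) (x : A) : act f (1 : FrobPoly p R) x = x := by rw [map_one]; rfl

lemma act_zero (f : R →+* A) (x : A) : act f (0 : FrobPoly p R) x = 0 := by rw [map_zero]; rfl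

lemma act_C (f : R →+* A) (a : R) (x : A) : act f (C a : FrobPoly p R) x = f a * x := by
  simpa using act_C_mul_F_pow (p := p) f 0 a x

lemma act_F_pow (f : R →+* A) (n : ℕ) (x : A) : act f (F ^ n : FrobPoly p R) x = x ^ p ^ n := by
  simpa using act_C_mul_F_pow (p := p) f n 1 x

/-- The commutation rule F^n τ = τ^{(n)} F^n, read as an identity of operators. -/
lemma act_pow (f : R →+* A) (τ : FrobPoly p R) (n : ℕ) (x : A) :
    (act f τ x) ^ p ^ n = act f (twist n τ) (x ^ p ^ n) := by
  rw [← act_F_pow f, ← act_mul, F_pow_mul_eq, act_mul, act_F_pow]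

lemma map_act (f : R →+* A) (g : A →+* B) (τ : FrobPoly p R) (x : A) :
    g (act f τ x) = act (g.comp f) τ (g x) := by
  refine induction (P := fun τ => g (act f τ x) = act (g.comp f) τ (g x)) τ ?_ ?_ ?_
  · rw [act_zero, act_zero, map_zero]
  · intro σ τ h h'
    rw [act_add, act_add, map_add, h, h']
  · intro i a
    rw [act_C_mul_F_pow, act_C_mul_F_pow, map_mul, map_pow]
    rfl

lemma act_map {S : Type*} [CommRing S] [CharP S p] (j : R →+* S) (f : S →+* A)
    (τ : FrobPoly p R) (x : A) : act f (map j τ) x = act (f.comp j) τ x := by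
  refine induction (P := fun τ => act f (map j τ) x = act (f.comp j) τ x) τ ?_ ?_ ?_
  · rw [map_zero, act_zero, act_zero]
  · intro σ τ h h'
    rw [map_add, act_add, act_add, h, h']
  · intro i a
    rw [map_C_mul_F_pow, act_C_mul_F_pow, act_C_mul_F_pow]
    rfl

lemma act_mem (s : Subring A)
    {f : R →+* A} (hf : ∀ a, f a ∈ s) (τ : FrobPoly p R) {x : A} (hx : x ∈ s) : act f τ x ∈ s := by
  refine induction (P := fun τ => act f τ x ∈ s) τ ?_ ?_ ?_
  · rw [act_zero]; exact zero_mem s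
  · intro σ τ h h'
    rw [act_add]; exact add_mem h h'
  · intro i a
    rw [act_C_mul_F_pow]
    exact mul_mem (hf a) (pow_mem hx _)

lemma coeff_act_X (τ : FrobPoly p R) (i : ℕ) :
    (act Polynomial.C τ (Polynomial.X : Polynomial R)).coeff (p ^ i) = coeff τ i := by
  refine induction (P := fun τ => (act Polynomial.C τ (Polynomial.X : Polynomial R)).coeff (p ^ i)
    = coeff τ i) τ ?_ ?_ ?_
  · rw [act_zero]; rfl
  · intro σ τ h h'
    rw [act_add, Polynomial.coeff_add, h, h', coeff_add]
  · intro l a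
    rw [act_C_mul_F_pow, Polynomial.coeff_C_mul_X_pow, coeff_C_mul_F_pow]
    exact if_congr (by rw [(Nat.pow_right_injective (Fact.out : p.Prime).two_le).eq_iff, eq_comm])
      rfl rfl

/-- Apart from its linear term, an additive polynomial is a polynomial in X^p, which differentiation
kills. This constant derivative drives all the later descent arguments. -/
lemma derivative_act_X (τ : FrobPoly p R) :
    Polynomial.derivative (act Polynomial.C τ (Polynomial.X : Polynomial R)) =
      Polynomial.C (coeff τ 0) := by
  obtain ⟨ρ, hρ⟩ := exists_eq_C_add_mul_F τ
  nth_rw 1 [hρ]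
  have h := act_F_pow (p := p) (Polynomial.C : R →+* _) 1 Polynomial.X
  rw [pow_one, pow_one] at h
  have h2 : act Polynomial.C ρ ((Polynomial.X : Polynomial R) ^ p) =
      Polynomial.expand R p (act Polynomial.C ρ Polynomial.X) := by
    change _ = (Polynomial.expand R p : Polynomial R →+* Polynomial R) _
    rw [map_act]
    have e : (Polynomial.expand R p : Polynomial R →+* Polynomial R).comp Polynomial.C =
        Polynomial.C := RingHom.ext fun a => Polynomial.expand_C p a
    rw [e]
    exact congrArg _ (Polynomial.expand_X p).symm
  rw [act_add, act_mul, h, h2, Polynomial.derivative_add, Polynomial.derivative_expand]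
  simp [act_C]

/-- `τ^{(n)}` is onto if the coefficients have `p ^ n`-th roots. -/
lemma exists_twist_eq (n : ℕ) (τ : FrobPoly p R) (h : ∀ i, ∃ b, b ^ p ^ n = coeff τ i) :
    ∃ σ, twist n σ = τ := by
  obtain ⟨N, hN⟩ := exists_coeff_eq_zero τ
  choose b hb using h
  -- The chosen roots are cut off at N because R may have nilpotents, so a chosen root of a zero
  -- coefficient need not vanish.
  obtain ⟨σ, hσ⟩ := exists_coeff_eq (p := p) (fun i => if i < N then b i else 0) N
    fun i hi => if_neg (not_lt.2 hi)
  refine ⟨σ, ext fun i => ?_⟩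
  rw [coeff_twist, hσ]
  split_ifs with hi
  · exact hb i
  · rw [hN i (not_lt.1 hi), zero_pow (pow_ne_zero _ (expChar_ne_zero R p))]

end Act
end FrobPoly
end RussellForms

/-! ### The subring R[T^(p^n), b(T)] of E[T]. -/

namespace RussellForms
open Polynomial
open FrobPoly hiding C coeff coeff_map coeff_add coeff_sum ext map induction

/-- Evaluation of a polynomial in two variables, over an extension of the constants. -/
def planeEval {R A : Type*} [CommRing R] [CommRing A] (f : R →+* A) (x y : A) : R[X][X] →+* A :=
  eval₂RingHom (eval₂RingHom f x) y

section PlaneEval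

variable {R A : Type*} [CommRing R] [CommRing A] (f : R →+* A) (x y : A)

lemma planeEval_C_C (a : R) : planeEval f x y (C (C a)) = f a := by simp [planeEval]

lemma planeEval_C_X : planeEval f x y (C X) = x := by simp [planeEval]

lemma planeEval_C (a : R[X]) : planeEval f x y (C a) = a.eval₂ f x := by simp [planeEval]

lemma planeEval_X : planeEval f x y X = y := by simp [planeEval]

lemma ringHom_ext_plane {g h : R[X][X] →+* A} (h0 : ∀ a, g (C (C a)) = h (C (C a)))
    (h1 : g (C X) = h (C X)) (h2 : g X = h X) : g = h :=
  Polynomial.ringHom_ext' (Polynomial.ringHom_ext h0 h1) h2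

end PlaneEval

section CharP

variable {p : ℕ} [Fact p.Prime] {R E : Type*} [Field R] [Field E] [CharP E p]

/-- The polynomial `b(T) = ∑ b_i T ^ (p ^ i)`. -/
def additivePoly (b : FrobPoly p E) : E[X] := act C b X

lemma additivePoly_add (b c : FrobPoly p E) :
    additivePoly (b + c) = additivePoly b + additivePoly c := act_add _ _ _ _

lemma additivePoly_sub (b c : FrobPoly p E) :
    additivePoly (b - c) = additivePoly b - additivePoly c :=
  eq_sub_of_add_eq (by rw [← additivePoly_add, sub_add_cancel])

lemma additivePoly_C_mul (a : E) (b : FrobPoly p E) :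
    additivePoly (FrobPoly.C a * b) = C a * additivePoly b := by
  rw [additivePoly, act_mul, act_C]; rfl

lemma derivative_additivePoly (b : FrobPoly p E) :
    derivative (additivePoly b) = C (b.coeff 0) := derivative_act_X b

lemma expand_act (b : FrobPoly p E) (f : E[X]) :
    expand E p (act C b f) = act C b (expand E p f) := by
  change (expand E p : E[X] →+* E[X]) _ = _
  rw [map_act]
  have e : (expand E p : E[X] →+* E[X]).comp C = C := RingHom.ext fun a => expand_C p a
  rw [e]
  rfl

lemma additivePoly_mul_F (b : FrobPoly p E) :
    additivePoly (b * F) = expand E p (additivePoly b) := by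
  rw [additivePoly, additivePoly, act_mul, expand_act, expand_X, ← pow_one F, act_F_pow, pow_one]

lemma additivePoly_pow (b : FrobPoly p E) :
    additivePoly b ^ p = expand E p (additivePoly (twist 1 b)) := by
  rw [← additivePoly_mul_F, ← pow_one F, ← F_pow_mul_eq, additivePoly, additivePoly, act_mul,
    act_F_pow, pow_one]

/-- Since b(T)^p = b^{(1)}(T^p), substituting Y^p for the outer variable Y makes the value a
polynomial in T^p. Extracting it lowers n by one and replaces b by b^{(1)}: this is the induction
step of the results below. -/
lemma planeEval_expand (j : R →+* E) (n : ℕ) (b : FrobPoly p E) (P : R[X][X]) :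
    planeEval (C.comp j) (X ^ p ^ (n + 1)) (additivePoly b) (expand R[X] p P) =
      expand E p (planeEval (C.comp j) (X ^ p ^ n) (additivePoly (twist 1 b)) P) := by
  refine DFunLike.congr_fun (f := (planeEval (C.comp j) (X ^ p ^ (n + 1)) (additivePoly b)).comp
    (expand R[X] p : R[X][X] →+* R[X][X])) (g := (expand E p : E[X] →+* E[X]).comp
    (planeEval (C.comp j) (X ^ p ^ n) (additivePoly (twist 1 b)))) (ringHom_ext_plane ?_ ?_ ?_) P
  · intro a
    change planeEval _ _ _ (expand R[X] p (C (C a))) = expand E p (planeEval _ _ _ (C (C a)))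
    rw [expand_C, planeEval_C_C, planeEval_C_C]
    exact (expand_C p _).symm
  · change planeEval _ _ _ (expand R[X] p (C X)) = expand E p (planeEval _ _ _ (C X))
    rw [expand_C, planeEval_C_X, planeEval_C_X, map_pow, expand_X, ← pow_mul, ← pow_succ']
  · change planeEval _ _ _ (expand R[X] p X) = expand E p (planeEval _ _ _ X)
    rw [expand_X, map_pow, planeEval_X, planeEval_X, additivePoly_pow]

/-- Chain rule: T^(p^(n+1)) has derivative zero, so only the partial derivative in the outer
variable survives, multiplied by the constant derivative b_0 of b(T). -/
lemma derivative_planeEval (j : R →+* E) (n : ℕ) (b : FrobPoly p E) (P : R[X][X]) :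
    derivative (planeEval (C.comp j) (X ^ p ^ (n + 1)) (additivePoly b) P) =
      planeEval (C.comp j) (X ^ p ^ (n + 1)) (additivePoly b) (derivative P) *
        C (b.coeff 0) := by
  have hC (a : R[X]) :
      derivative (planeEval (C.comp j) (X ^ p ^ (n + 1)) (additivePoly b) (C a)) = 0 := by
    have h := planeEval_expand j n b (C a)
    rw [expand_C] at h
    rw [h, derivative_expand, CharP.cast_eq_zero, zero_mul, mul_zero]
  induction P using Polynomial.induction_on' with
  | add P Q hP hQ => rw [map_add, map_add, map_add, map_add, hP, hQ, add_mul]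
  | monomial i a =>
    rw [← C_mul_X_pow_eq_monomial, map_mul, derivative_mul, hC, zero_mul, zero_add,
      derivative_C_mul, map_mul, mul_assoc, map_pow, derivative_pow, derivative_X_pow,
      planeEval_X, map_mul, map_pow, planeEval_X, map_natCast C, map_natCast, map_natCast,
      derivative_additivePoly]

variable {b : FrobPoly p E}

lemma exists_expand_of_derivative_eq_zero [CharP R p] {P : R[X][X]} {n : ℕ} (hP : derivative P = 0)
    (hd : P.natDegree < p ^ (n + 1)) :
    ∃ Q : R[X][X], expand R[X] p Q = P ∧ Q.natDegree < p ^ n := by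
  have h := expand_contract p hP (Fact.out : p.Prime).ne_zero
  refine ⟨contract p P, h, ?_⟩
  rw [← h, natDegree_expand, pow_succ] at hd
  exact lt_of_mul_lt_mul_right hd (Nat.zero_le _)

/-- The monomials `T ^ (p ^ n i) b(T) ^ j` with `j < p ^ n` are linearly independent. -/
lemma planeEval_eq_zero (n : ℕ) (hb : b.coeff 0 ≠ 0) (P : E[X][X]) (hd : P.natDegree < p ^ n)
    (hP : planeEval C (X ^ p ^ n) (additivePoly b) P = 0) : P = 0 := by
  induction n generalizing b P with
  | zero =>
    rw [pow_zero, Nat.lt_one_iff] at hd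
    rw [eq_C_of_natDegree_eq_zero hd] at hP ⊢
    rw [planeEval_C, pow_zero, pow_one, eval₂_C_X] at hP
    rw [hP, map_zero]
  | succ n ih =>
    -- The inner induction on the degree in Y applies to the partial derivative of P, which
    -- satisfies the same relation because b_0 is nonzero. Once that derivative vanishes, P is a
    -- polynomial in Y^p and the outer induction applies to b^{(1)}.
    induction hm : P.natDegree using Nat.strong_induction_on generalizing P with
    | _ m ihm =>
      have hP' : derivative P = 0 := by
        by_cases h0 : P.natDegree = 0
        · rw [eq_C_of_natDegree_eq_zero h0, derivative_C]
        · have hlt := natDegree_derivative_lt h0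
          refine ihm _ (hm ▸ hlt) _ (hlt.trans hd) ?_ rfl
          have h := derivative_planeEval (RingHom.id E) n b P
          rw [RingHom.comp_id, hP, derivative_zero, eq_comm, mul_eq_zero] at h
          exact h.resolve_right (C_ne_zero.2 hb)
      obtain ⟨Q, rfl, hQ⟩ := exists_expand_of_derivative_eq_zero hP' hd
      have h := planeEval_expand (RingHom.id E) n b Q
      rw [RingHom.comp_id, hP, eq_comm, expand_eq_zero (Fact.out : p.Prime).pos] at h
      rw [ih (b := twist 1 b) (by rw [coeff_twist]; exact pow_ne_zero _ hb) Q hQ h, map_zero]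

/-- A polynomial in `T ^ (p ^ n)` and `b(T)` which is constant in `T` is constant. -/
lemma eq_C_C_of_planeEval_eq_C (j : R →+* E) (n : ℕ) (hb : b.coeff 0 ≠ 0) (P : R[X][X])
    (hd : P.natDegree < p ^ n) (c : E)
    (hP : planeEval (C.comp j) (X ^ p ^ n) (additivePoly b) P = C c) : ∃ e, P = C (C e) := by
  -- Independence holds over E, so the coefficients of P are first extended to E. Comparing
  -- coefficients afterwards shows that c already comes from R.
  have hmap : planeEval C (X ^ p ^ n) (additivePoly b) (P.map (mapRingHom j)) = C c := by
    rw [← hP]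
    refine DFunLike.congr_fun (f := (planeEval C (X ^ p ^ n) (additivePoly b)).comp
      (mapRingHom (mapRingHom j))) (ringHom_ext_plane ?_ ?_ ?_) P
    · intro a
      simp [planeEval]
    · simp [planeEval]
    · simp [planeEval]
  have h0 := planeEval_eq_zero n hb (P.map (mapRingHom j) - C (C c))
    ((natDegree_sub_C).trans_lt (natDegree_map_le.trans_lt hd))
    (by rw [map_sub, hmap, planeEval_C_C, sub_self])
  refine ⟨(P.coeff 0).coeff 0, ?_⟩
  ext i l
  have h := congrArg (fun f => (Polynomial.coeff f i).coeff l) (sub_eq_zero.1 h0)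
  simp only [coeff_map, coe_mapRingHom] at h
  rw [coeff_C]
  rw [coeff_C] at h
  split_ifs with hi
  · subst hi
    rw [coeff_C]
    split_ifs with hl
    · rw [hl]
    · rw [if_pos rfl, coeff_C, if_neg hl] at h
      exact j.injective (h.trans (map_zero j).symm)
  · rw [if_neg hi, coeff_zero] at h
    rw [coeff_zero]
    exact j.injective (h.trans (map_zero j).symm)

/-- The additive polynomials in the subring `R[T ^ (p ^ n), b(T)]` are those in
`R[F] b + R[F] F ^ n`. -/
lemma exists_eq_map_mul_add [CharP R p] (j : R →+* E) (n : ℕ) (hb : b.coeff 0 ≠ 0) (P : R[X][X])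
    (hd : P.natDegree < p ^ n) (f : FrobPoly p E)
    (hP : planeEval (C.comp j) (X ^ p ^ n) (additivePoly b) P = additivePoly f) :
    ∃ σ ρ : FrobPoly p R, f = FrobPoly.map j σ * b + FrobPoly.map j ρ * F ^ n := by
  induction n generalizing b P f with
  | zero =>
    rw [pow_zero, Nat.lt_one_iff] at hd
    rw [eq_C_of_natDegree_eq_zero hd, planeEval_C, pow_zero, pow_one] at hP
    obtain ⟨N, hN⟩ := exists_coeff_eq_zero f
    -- For n = 0 the subring is R[T], so f itself has coefficients in R and σ = 0 will do.
    have hc (i : ℕ) : j ((P.coeff 0).coeff (p ^ i)) = FrobPoly.coeff f i := by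
      rw [← coeff_act_X, ← additivePoly, ← hP, ← coeff_map]
      congr 1
    obtain ⟨ρ, hρ⟩ := exists_coeff_eq (p := p) (fun i => (P.coeff 0).coeff (p ^ i)) N
      fun i hi => j.injective (by rw [hc, hN i hi, map_zero])
    refine ⟨0, ρ, FrobPoly.ext fun i => ?_⟩
    rw [map_zero, zero_mul, zero_add, pow_zero, mul_one, FrobPoly.coeff_map, hρ, hc]
  | succ n ih =>
    have hp := (Fact.out : p.Prime)
    have hD := derivative_planeEval j n b P
    rw [hP, derivative_additivePoly] at hD
    -- Differentiating in T shows that the partial derivative of P takes the constant value f_0 /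
    -- b_0, hence is a constant e of R.
    obtain ⟨e, he⟩ := eq_C_C_of_planeEval_eq_C j (n + 1) hb (derivative P)
      ((natDegree_derivative_le P).trans_lt ((Nat.sub_le _ _).trans_lt hd))
      (FrobPoly.coeff f 0 / b.coeff 0) (mul_right_cancel₀ (C_ne_zero.2 hb) (by
        rw [← hD, ← map_mul, div_mul_cancel₀ _ hb]))
    have he0 : FrobPoly.coeff f 0 = j e * b.coeff 0 := C_injective (by
      rw [hD, he, planeEval_C_C, map_mul]; rfl)
    -- Subtracting eY from P leaves a polynomial in Y^p, and correspondingly f - eb has no linear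
    -- term, so it equals gF. The induction hypothesis applies to g and b^{(1)}.
    obtain ⟨Q, hQ, hQd⟩ := exists_expand_of_derivative_eq_zero (P := P - C (C e) * X) (n := n)
      (by rw [derivative_sub, he, derivative_C_mul, derivative_X, mul_one, sub_self])
      ((natDegree_sub_le _ _).trans_lt (max_lt hd (((natDegree_C_mul_le _ _).trans natDegree_X_le).trans_lt
        (Nat.one_lt_pow (Nat.succ_ne_zero n) hp.one_lt))))
    obtain ⟨g, hg⟩ := exists_eq_C_add_mul_F (f - FrobPoly.C (j e) * b)
    have h0 : FrobPoly.coeff (f - FrobPoly.C (j e) * b) 0 = 0 := by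
      have h : FrobPoly.coeff (f - FrobPoly.C (j e) * b) 0 +
          FrobPoly.coeff (FrobPoly.C (j e) * b) 0 = FrobPoly.coeff f 0 := by
        rw [← FrobPoly.coeff_add, sub_add_cancel]
      rw [coeff_mul_zero, FrobPoly.coeff_C_zero, ← he0] at h
      exact add_eq_right.1 h
    rw [h0, map_zero, zero_add] at hg
    obtain ⟨σ, ρ, h⟩ := ih (b := twist 1 b) (by rw [coeff_twist]; exact pow_ne_zero _ hb) Q hQd g
      (expand_injective hp.pos (by
        rw [← planeEval_expand, ← additivePoly_mul_F, ← hg, hQ, map_sub, hP, map_mul,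
          planeEval_C_C, planeEval_X, additivePoly_sub, additivePoly_C_mul]
        rfl))
    -- From g = σb^{(1)} + ρF^n and b^{(1)}F = Fb one gets gF = σFb + ρF^(n+1).
    refine ⟨FrobPoly.C e + σ * F, ρ, ?_⟩
    have hF := F_pow_mul_eq 1 b
    rw [pow_one] at hF
    rw [sub_eq_iff_eq_add.1 hg, h, map_add, map_mul, map_F, FrobPoly.map_C, add_mul, add_mul, mul_assoc,
      ← hF, mul_assoc, mul_assoc, ← pow_succ]
    abel

end CharP
end RussellForms

namespace RussellForms
open Polynomial
open FrobPoly hiding C coeff coeff_map coeff_add coeff_sum ext map induction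

/-! ### Inverting separable elements modulo F^n. -/

section Inverse

variable {p : ℕ} {E : Type*} [Field E] [ExpChar E p]

/-- A separable `b` is invertible modulo `E[F] F ^ n`. -/
lemma exists_inverse_mod (n : ℕ) {b : FrobPoly p E} (hb : b ∈ sep p E) :
    ∃ ρ h h' : FrobPoly p E, ρ * b = 1 + h * F ^ n ∧ b * ρ = 1 + h' * F ^ n ∧
      h' * twist n b = b * h := by
  obtain ⟨ρ, hρ, h, hh⟩ := exists_left_inv n b hb
  obtain ⟨ρ₂, -, m, hm⟩ := exists_left_inv n ρ hρ
  -- `exists_left_inv` works modulo F^(n+1); only F^n is needed, so the extra F is absorbed into h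
  -- and m.
  rw [pow_succ', ← mul_assoc] at hh hm
  generalize h * F = h at hh
  generalize m * F = m at hm
  -- As for inverses in a monoid, the left inverse ρ₂ of ρ agrees with b modulo F^n, so ρ is also a
  -- right inverse of b.
  have key : b * ρ = 1 + (m - (m * twist n b - ρ₂ * h) * twist n ρ) * F ^ n := by
    have h1 : ρ₂ + ρ₂ * h * F ^ n = b + m * twist n b * F ^ n := by
      rw [mul_assoc m, ← F_pow_mul_eq, mul_assoc ρ₂]
      calc ρ₂ + ρ₂ * (h * F ^ n) = ρ₂ * (1 + h * F ^ n) := by rw [mul_add, mul_one]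
        _ = (1 + m * F ^ n) * b := by rw [← hh, ← mul_assoc, hm]
        _ = _ := by rw [add_mul, one_mul, mul_assoc]
    have h2 : b = ρ₂ - (m * twist n b - ρ₂ * h) * F ^ n := by
      rw [sub_mul, eq_sub_iff_add_eq, ← add_sub_assoc, sub_eq_iff_eq_add, h1]
    nth_rw 1 [h2]
    rw [sub_mul, hm, mul_assoc _ (F ^ n), F_pow_mul_eq, ← mul_assoc, sub_mul m]
    abel
  -- The compatibility of h and h' comes from computing bρb in two ways and cancelling F^n on the
  -- right.
  refine ⟨ρ, h, _, hh, key, mul_F_pow_cancel n ?_⟩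
  rw [mul_assoc, ← F_pow_mul_eq, ← mul_assoc, ← sub_eq_iff_eq_add'.2 key, sub_mul, mul_assoc, hh,
    mul_add, mul_one, one_mul, add_sub_cancel_left, mul_assoc]

end Inverse

/-! ### Parametrising the solutions of y^(p^n) = b^{(n)}(x). -/

section Root

variable {p : ℕ} [Fact p.Prime] {E A : Type*} [Field E] [CharP E p] [CommRing A] (f : E →+* A)
  {n : ℕ} {b ρ h h' : FrobPoly p E}

/-- This and the next two lemmas say that t ↦ (t^(p^n), b(t)) and (x, y) ↦ ρ(y) - h(x) are mutually
inverse. They hold in every E-algebra, reduced or not. -/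
lemma act_sub_eq_self (h1 : ρ * b = 1 + h * F ^ n) (t : A) :
    act f ρ (act f b t) - act f h (t ^ p ^ n) = t := by
  rw [← act_mul, h1, act_add, act_one, act_mul, act_F_pow, add_sub_cancel_right]

lemma act_sub_pow (h1 : ρ * b = 1 + h * F ^ n) {x y : A}
    (hxy : y ^ p ^ n = act f (twist n b) x) : (act f ρ y - act f h x) ^ p ^ n = x := by
  have e : twist n ρ * twist n b = 1 + twist n h * F ^ n := by
    rw [← map_mul, h1, map_add, map_one, map_mul, twist_F_pow]
  rw [← act_F_pow f, map_sub, ← act_mul, ← act_mul, F_pow_mul_eq, F_pow_mul_eq, act_mul,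
    act_F_pow, hxy, ← act_mul, e, act_add, act_one, add_sub_cancel_right]

/-- Applying b gives y + h'(y^(p^n)) - bh(x), and the last two terms cancel by the compatibility
`h3`. -/
lemma act_act_sub (h2 : b * ρ = 1 + h' * F ^ n) (h3 : h' * twist n b = b * h) {x y : A}
    (hxy : y ^ p ^ n = act f (twist n b) x) : act f b (act f ρ y - act f h x) = y := by
  rw [map_sub, ← act_mul, ← act_mul, h2, ← h3, act_add, act_one, act_mul, act_mul, act_F_pow, hxy,
    add_sub_cancel_right]

end Root

/-! ### Comparing the subrings attached to two twisted polynomials. -/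

section Core

variable {p : ℕ} [Fact p.Prime] {R E : Type*} [Field R] [CharP R p] [Field E] [CharP E p]

lemma mem_sep_of_twist_eq_map {n : ℕ} {j : R →+* E} {b : FrobPoly p E} {τ : FrobPoly p R}
    (hτ : τ ∈ sep p R) (h : twist n b = FrobPoly.map j τ) : b ∈ sep p E := by
  intro h0
  have e := congrArg (fun x => FrobPoly.coeff x 0) h
  simp only [coeff_twist, FrobPoly.coeff_map, h0] at e
  rw [zero_pow (pow_ne_zero _ (Fact.out : p.Prime).ne_zero)] at e
  exact hτ (j.injective (e.symm.trans (map_zero j).symm))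

lemma additivePoly_comp (b : FrobPoly p E) (w : E[X]) :
    (additivePoly b).comp w = act C b w := by
  change compRingHom w (act C b X) = _
  rw [map_act]
  have e : (compRingHom w).comp C = C := RingHom.ext fun a => C_comp
  rw [e]
  exact congrArg _ X_comp

lemma comp_planeEval (j : R →+* E) (x y w : E[X]) (P : R[X][X]) :
    (planeEval (C.comp j) x y P).comp w = planeEval (C.comp j) (x.comp w) (y.comp w) P :=
  DFunLike.congr_fun (f := (compRingHom w).comp (planeEval (C.comp j) x y))
    (ringHom_ext_plane (by simp [planeEval]) (by simp [planeEval]) (by simp [planeEval])) P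

/-- A separable substitution `w`, from which `T` can be recovered polynomially, is linear. -/
lemma exists_eq_C_mul_X_add_C {G w : E[X]} (h : G.comp w = X) :
    ∃ c d : E, c ≠ 0 ∧ w = C c * X + C d := by
  have hd := congrArg natDegree h
  rw [natDegree_comp, natDegree_X] at hd
  have hw : w.natDegree = 1 := Nat.eq_one_of_mul_eq_one_left hd
  obtain ⟨c, d, rfl⟩ := exists_eq_X_add_C_of_natDegree_le_one hw.le
  refine ⟨c, d, ?_, rfl⟩
  rintro rfl
  rw [map_zero, zero_mul, zero_add, natDegree_C] at hw
  exact zero_ne_one hw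

lemma eval_zero_additivePoly (b : FrobPoly p E) : (additivePoly b).eval 0 = 0 := by
  have h := additivePoly_comp b 0
  rw [map_zero, comp_zero] at h
  exact C_eq_zero.1 h

/-- An element of `R[T ^ (p ^ n), b(T)]` which is an additive polynomial up to a constant. -/
lemma exists_eq_map_mul_add_of_planeEval (j : R →+* E) (n : ℕ) {τ : FrobPoly p R}
    (hτ : τ ∈ sep p R) {b : FrobPoly p E} (hb : twist n b = FrobPoly.map j τ) (Q : R[X][X])
    (f : FrobPoly p E) (d : E)
    (hQ : planeEval (C.comp j) (X ^ p ^ n) (additivePoly b) Q = additivePoly f + C d) :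
    ∃ σ ρ : FrobPoly p R, f = FrobPoly.map j σ * b + FrobPoly.map j ρ * F ^ n := by
  have hp := (Fact.out : p.Prime)
  have hq : p ^ n ≠ 0 := pow_ne_zero _ hp.ne_zero
  -- At T = 0 both T^(p^n) and b(T) vanish, so d is the constant coefficient of Q and may be
  -- subtracted inside the subring.
  have hd : j ((Q.coeff 0).coeff 0) = d := by
    have h := congrArg (eval 0) hQ
    rw [eval_add, eval_zero_additivePoly, eval_C, zero_add] at h
    rw [← h]
    have e : (evalRingHom 0).comp (planeEval (C.comp j) (X ^ p ^ n) (additivePoly b)) =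
        (j.comp (evalRingHom 0)).comp (evalRingHom 0) := ringHom_ext_plane
      (fun a => by simp [planeEval]) (by simp [planeEval, hp.ne_zero])
      (by simp [planeEval, eval_zero_additivePoly])
    rw [coeff_zero_eq_eval_zero, coeff_zero_eq_eval_zero]
    exact (DFunLike.congr_fun e Q).symm
  -- M is the defining relation of A(τ), monic in Y and zero on (T^(p^n), b(T)). Division by it
  -- brings the degree in Y below p^n.
  set M : R[X][X] := X ^ p ^ n - C (act C τ X)
  have hM : M.Monic := monic_X_pow_sub_C _ hq
  have hMd : M.natDegree = p ^ n := natDegree_X_pow_sub_C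
  have hM0 : planeEval (C.comp j) (X ^ p ^ n) (additivePoly b) M = 0 := by
    rw [map_sub, map_pow, planeEval_X, planeEval_C, additivePoly, act_pow, hb, act_map,
      ← coe_eval₂RingHom, map_act, coe_eval₂RingHom, eval₂_X, sub_eq_zero]
    congr 2
    exact RingHom.ext fun a => by simp
  refine exists_eq_map_mul_add j n (mem_sep_of_twist_eq_map hτ hb)
    ((Q - C (C ((Q.coeff 0).coeff 0))) %ₘ M) ?_ f ?_
  · rw [← hMd]
    exact natDegree_modByMonic_lt _ hM fun h => hq (by rw [← hMd, h, natDegree_one])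
  · have h := congrArg (planeEval (C.comp j) (X ^ p ^ n) (additivePoly b))
      (modByMonic_add_div (Q - C (C ((Q.coeff 0).coeff 0))) M)
    rw [map_add, map_mul, hM0, zero_mul, add_zero, map_sub, hQ, planeEval_C_C] at h
    rw [h, RingHom.comp_apply, hd, add_sub_cancel_right]

/-- If the subrings `R[T ^ (p ^ n), b(T)]` and `R[T ^ (p ^ n), b'(T)]` of `E[T]` are isomorphic,
then `τ` and `τ'` are equivalent. -/
theorem exists_twist_mul_add (j : R →+* E) {n : ℕ} (hn : n ≠ 0) {τ τ' : FrobPoly p R}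
    (hτ : τ ∈ sep p R) (hτ' : τ' ∈ sep p R) {b b' : FrobPoly p E}
    (hb : twist n b = FrobPoly.map j τ) (hb' : twist n b' = FrobPoly.map j τ')
    {u v : E[X]} (huv : v ^ p ^ n = act (C.comp j) τ' u) (Q : R[X][X])
    (hv : planeEval (C.comp j) (X ^ p ^ n) (additivePoly b) Q = v)
    (P' Q' : R[X][X]) (hP' : planeEval (C.comp j) u v P' = X ^ p ^ n)
    (hQ' : planeEval (C.comp j) u v Q' = additivePoly b) :
    ∃ σ ∈ sep p R, ∃ (c : Rˣ) (ρ : FrobPoly p R),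
      τ' * FrobPoly.C (c : R) = twist n σ * τ + F ^ n * ρ := by
  have hbs := mem_sep_of_twist_eq_map hτ hb
  have hbs' := mem_sep_of_twist_eq_map hτ' hb'
  rw [← act_map, ← hb'] at huv
  obtain ⟨w, hwu, hwv⟩ : ∃ w : E[X], w ^ p ^ n = u ∧ act C b' w = v := by
    obtain ⟨ρ, h, h', h1, h2, h3⟩ := exists_inverse_mod n hbs'
    exact ⟨_, act_sub_pow C h1 huv, act_act_sub C h2 h3 huv⟩
  -- Since u = w^(p^n) and v = b'(w), every polynomial in u and v is a polynomial in w. In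
  -- particular so are T^(p^n) and b(T), hence T = ρ(b(T)) - h(T^(p^n)), and w must have degree one.
  obtain ⟨c, d, hc, rfl⟩ : ∃ c d : E, c ≠ 0 ∧ w = C c * X + C d := by
    obtain ⟨ρ, h, h', h1, -, -⟩ := exists_inverse_mod n hbs
    have hw (P : R[X][X]) : planeEval (C.comp j) u v P =
        (planeEval (C.comp j) (X ^ p ^ n) (additivePoly b') P).comp w := by
      rw [comp_planeEval, X_pow_comp, additivePoly_comp, hwu, hwv]
    rw [hw] at hP' hQ'
    have hact (σ : FrobPoly p E) (g : E[X]) : act C σ (g.comp w) = (act C σ g).comp w := by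
      change _ = compRingHom w _
      rw [map_act]
      have e : (compRingHom w).comp C = C := RingHom.ext fun a => C_comp
      rw [e]
      rfl
    have key := act_sub_eq_self C h1 (X : E[X])
    change act C ρ (additivePoly b) - _ = _ at key
    rw [← hP', ← hQ', hact, hact, ← sub_comp] at key
    exact exists_eq_C_mul_X_add_C key
  rw [map_add, ← act_C, ← act_mul] at hwv
  -- Here v = b'(cT + d) is the additive polynomial of b'c plus the constant b'(d).
  obtain ⟨σ, ρ, h⟩ := exists_eq_map_mul_add_of_planeEval j n hτ hb Q (b' * FrobPoly.C c)
    (act (RingHom.id E) b' d) (by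
      rw [hv, ← hwv, map_act]
      rfl)
  replace h := congrArg (twist n) h
  rw [map_mul, map_add, map_mul, map_mul, hb, hb', twist_C, twist_F_pow, ← map_twist, ← map_twist,
    ← map_mul] at h
  -- As n > 0, the term in F^n does not affect the constant coefficients. Comparing them shows that
  -- c^(p^n), a priori in E, comes from R, and that σ is separable.
  have h0 := congrArg (fun x => FrobPoly.coeff x 0) h
  simp only [FrobPoly.coeff_add, coeff_mul_F_pow_zero _ hn, add_zero,
    FrobPoly.coeff_map, coeff_mul_zero, FrobPoly.coeff_C_zero, coeff_twist] at h0
  have hc' : c ^ p ^ n ≠ 0 := pow_ne_zero _ hc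
  have hcj : c ^ p ^ n =
      j (FrobPoly.coeff σ 0 ^ p ^ n * FrobPoly.coeff τ 0 / FrobPoly.coeff τ' 0) := by
    rw [map_div₀, ← h0, mul_div_cancel_left₀ _ ((_root_.map_ne_zero j).2 hτ')]
  have hcr : FrobPoly.coeff σ 0 ^ p ^ n * FrobPoly.coeff τ 0 / FrobPoly.coeff τ' 0 ≠ 0 := by
    intro h
    rw [h, map_zero] at hcj
    exact hc' hcj
  refine ⟨σ, ?_, Units.mk0 _ hcr, ρ, ?_⟩
  · intro hσ
    rw [hσ, zero_pow (pow_ne_zero _ (Fact.out : p.Prime).ne_zero), zero_mul, zero_div] at hcr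
    exact hcr rfl
  · refine map_injective j.injective ?_
    rw [map_mul, FrobPoly.map_C, Units.val_mk0, ← hcj, h, map_add, F_pow_mul_eq, map_mul _ _ (F ^ n),
      map_pow, map_F]

end Core
end RussellForms

namespace RussellForms
open FrobPoly
open scoped TensorProduct

/-! ### Degree-preserving homomorphisms. -/

section Grading

variable {Γ : Type*} [AddCommGroup Γ] {k : Type*} [CommRing k] {𝒦 : Γ → AddSubgroup k}

/-- Homomorphisms out of a polynomial ring in variables of trivial degree preserve degrees if the
images of the variables have trivial degree. -/
lemma aeval_mem_of_mem {A : Type*} [CommRing A] [Algebra k A] {𝒜 : Γ → AddSubgroup A}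
    [SetLike.GradedMonoid 𝒜] (hA : ∀ γ, ∀ a ∈ 𝒦 γ, algebraMap k A a ∈ 𝒜 γ) {σ : Type*}
    {g : σ → A} (hg : ∀ i, g i ∈ 𝒜 0) {γ : Γ} {f : MvPolynomial σ k}
    (hf : f ∈ GradedAlg.polyGrading 𝒦 (fun _ : σ => 0) γ) : MvPolynomial.aeval g f ∈ 𝒜 γ := by
  rw [MvPolynomial.aeval_def, MvPolynomial.eval₂_eq]
  refine sum_mem fun I _ => ?_
  have h0 : Finsupp.weight (fun _ : σ => (0 : Γ)) I = 0 := by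
    rw [Finsupp.weight_apply]
    exact Finset.sum_eq_zero fun i _ => smul_zero _
  have h1 := hf I
  rw [h0, sub_zero] at h1
  have h2 : ∏ i ∈ I.support, g i ^ I i ∈ SetLike.GradeZero.subring 𝒜 :=
    prod_mem fun i _ => (SetLike.GradeZero.subring 𝒜).pow_mem (hg i) _
  have h := SetLike.GradedMul.mul_mem (hA _ _ h1) h2
  rwa [add_zero] at h

namespace GradedAlg

variable [DecidableEq Γ]
variable {ℓ : Type*} [CommRing ℓ] [Algebra k ℓ] {𝓛 : Γ → AddSubgroup ℓ}

lemma tmul_mem_tensorGrading {A : GradedAlg 𝒦} {δ γ : Γ} {b : ℓ} {a : A.carrier} (hb : b ∈ 𝓛 δ)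
    (ha : a ∈ A.grading γ) : b ⊗ₜ[k] a ∈ tensorGrading 𝓛 A (δ + γ) :=
  AddSubgroup.subset_closure ⟨δ, γ, rfl, b, hb, a, ha, rfl⟩

instance [SetLike.GradedMonoid 𝓛] (A : GradedAlg 𝒦) :
    SetLike.GradedMonoid (tensorGrading 𝓛 A) where
  one_mem := by
    have h := tmul_mem_tensorGrading (A := A) (SetLike.GradedOne.one_mem (A := 𝓛))
      (SetLike.GradedOne.one_mem (A := A.grading))
    rwa [add_zero] at h
  mul_mem := by
    intro i j x y (hx : x ∈ AddSubgroup.closure _) (hy : y ∈ AddSubgroup.closure _)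
    induction hx using AddSubgroup.closure_induction with
    | mem x hx =>
      obtain ⟨δ, γ, rfl, b, hb, a, ha, rfl⟩ := hx
      induction hy using AddSubgroup.closure_induction with
      | mem y hy =>
        obtain ⟨δ', γ', rfl, b', hb', a', ha', rfl⟩ := hy
        rw [Algebra.TensorProduct.tmul_mul_tmul, add_add_add_comm]
        exact tmul_mem_tensorGrading (SetLike.GradedMul.mul_mem hb hb')
          (SetLike.GradedMul.mul_mem ha ha')
      | zero => rw [mul_zero]; exact zero_mem _
      | add y z _ _ h h' => rw [mul_add]; exact add_mem h h'
      | neg y _ h => rw [mul_neg]; exact neg_mem h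
    | zero => rw [zero_mul]; exact zero_mem _
    | add x y _ _ h h' => rw [add_mul]; exact add_mem h h'
    | neg x _ h => rw [neg_mul]; exact neg_mem h

lemma algebraMap_mem_tensorGrading (A : GradedAlg 𝒦) {γ : Γ} {b : ℓ} (hb : b ∈ 𝓛 γ) :
    algebraMap ℓ (ℓ ⊗[k] A.carrier) b ∈ tensorGrading 𝓛 A γ := by
  have h := tmul_mem_tensorGrading (A := A) hb (SetLike.GradedOne.one_mem (A := A.grading))
  rwa [add_zero] at h

lemma one_tmul_mem_tensorGrading [SetLike.GradedMonoid 𝓛] {A : GradedAlg 𝒦} {γ : Γ}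
    {a : A.carrier} (ha : a ∈ A.grading γ) : (1 : ℓ) ⊗ₜ[k] a ∈ tensorGrading 𝓛 A γ := by
  have h := tmul_mem_tensorGrading (A := A) (SetLike.GradedOne.one_mem (A := 𝓛)) ha
  rwa [zero_add] at h

/-- By ℓ-linearity, b ⊗ a goes to b times the image of 1 ⊗ a, so degrees need only be checked on 1 ⊗
A. -/
lemma map_mem_tensorGrading [SetLike.GradedMonoid 𝓛] {A B : GradedAlg 𝒦}
    (φ : (ℓ ⊗[k] A.carrier) →ₐ[ℓ] (ℓ ⊗[k] B.carrier))
    (hφ : ∀ γ, ∀ a ∈ A.grading γ, φ (1 ⊗ₜ a) ∈ tensorGrading 𝓛 B γ) {γ : Γ}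
    {x : ℓ ⊗[k] A.carrier} (hx : x ∈ tensorGrading 𝓛 A γ) : φ x ∈ tensorGrading 𝓛 B γ := by
  induction hx using AddSubgroup.closure_induction with
  | mem x hx =>
    obtain ⟨δ, γ, rfl, b, hb, a, ha, rfl⟩ := hx
    have e : b ⊗ₜ[k] a = algebraMap ℓ (ℓ ⊗[k] A.carrier) b * (1 ⊗ₜ a) := by
      rw [Algebra.TensorProduct.algebraMap_apply, Algebra.TensorProduct.tmul_mul_tmul, mul_one,
        one_mul]
      rfl
    rw [e, map_mul, AlgHom.commutes]
    exact SetLike.GradedMul.mul_mem (algebraMap_mem_tensorGrading B hb) (hφ γ a ha)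
  | zero => rw [map_zero]; exact zero_mem _
  | add x y _ _ h h' => rw [map_add]; exact add_mem h h'
  | neg x _ h => rw [map_neg]; exact neg_mem h

lemma Iso.of_algHom {A B : GradedAlg 𝒦} (φ : A.carrier →ₐ[k] B.carrier)
    (ψ : B.carrier →ₐ[k] A.carrier) (h : φ.comp ψ = AlgHom.id k _) (h' : ψ.comp φ = AlgHom.id k _)
    (hφ : ∀ γ, ∀ a ∈ A.grading γ, φ a ∈ B.grading γ)
    (hψ : ∀ γ, ∀ b ∈ B.grading γ, ψ b ∈ A.grading γ) : Iso A B :=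
  ⟨AlgEquiv.ofAlgHom φ ψ h h', fun γ x => ⟨fun hx => by
    have e := hψ γ _ hx
    rwa [show ψ (AlgEquiv.ofAlgHom φ ψ h h' x) = x from DFunLike.congr_fun h' x] at e, hφ γ x⟩⟩

lemma IsForm.of_algHom {B A : GradedAlg 𝒦} (φ : (ℓ ⊗[k] A.carrier) →ₐ[ℓ] (ℓ ⊗[k] B.carrier))
    (ψ : (ℓ ⊗[k] B.carrier) →ₐ[ℓ] (ℓ ⊗[k] A.carrier)) (h : φ.comp ψ = AlgHom.id ℓ _)
    (h' : ψ.comp φ = AlgHom.id ℓ _)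
    (hφ : ∀ γ, ∀ a ∈ tensorGrading 𝓛 A γ, φ a ∈ tensorGrading 𝓛 B γ)
    (hψ : ∀ γ, ∀ b ∈ tensorGrading 𝓛 B γ, ψ b ∈ tensorGrading 𝓛 A γ) : IsForm 𝓛 B A :=
  ⟨AlgEquiv.ofAlgHom φ ψ h h', fun γ x => ⟨fun hx => by
    have e := hψ γ _ hx
    rwa [show ψ (AlgEquiv.ofAlgHom φ ψ h h' x) = x from DFunLike.congr_fun h' x] at e, hφ γ x⟩⟩

end GradedAlg

end Grading

/-! ### Generators, relation and universal property of A(τ). -/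

section Russell

variable {Γ : Type*} [AddCommGroup Γ] [DecidableEq Γ] {k : Type*} [CommRing k]
  (𝒦 : Γ → AddSubgroup k) [GradedRing 𝒦] {p : ℕ} [Fact p.Prime] [CharP k p]

/-- The structure map of a `k`-algebra, on the constants of degree zero. -/
def zeroMap (A : Type*) [CommRing A] [Algebra k A] : 𝒦 0 →+* A :=
  (algebraMap k A).comp (SetLike.GradeZero.subring 𝒦).subtype

lemma comp_zeroMap {A B : Type*} [CommRing A] [Algebra k A] [CommRing B] [Algebra k B]
    (φ : A →ₐ[k] B) : (φ : A →+* B).comp (zeroMap 𝒦 A) = zeroMap 𝒦 B :=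
  RingHom.ext fun a => φ.commutes (a : k)

lemma algHom_act_zeroMap {A B : Type*} [CommRing A] [Algebra k A] [CommRing B] [Algebra k B]
    (φ : A →ₐ[k] B) (τ : FrobPoly p (𝒦 0)) (x : A) :
    φ (act (zeroMap 𝒦 A) τ x) = act (zeroMap 𝒦 B) τ (φ x) := by
  rw [← comp_zeroMap 𝒦 φ]
  exact map_act _ (φ : A →+* B) τ x

lemma algHom_act_algebraMap {ℓ E A B : Type*} [CommRing ℓ] [CommRing E] [CharP E p] [CommRing A]
    [Algebra ℓ A] [CommRing B] [Algebra ℓ B] (f : E →+* ℓ) (φ : A →ₐ[ℓ] B) (τ : FrobPoly p E)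
    (x : A) : φ (act ((algebraMap ℓ A).comp f) τ x) = act ((algebraMap ℓ B).comp f) τ (φ x) := by
  rw [← φ.comp_algebraMap, RingHom.comp_assoc]
  exact map_act _ (φ : A →+* B) τ x

/-- Links the explicit sum in the definition of A(τ) with the operator calculus of `act`. -/
lemma pPoly_eq_act (τ : FrobPoly p (𝒦 0)) {A : Type*} [CommRing A] [Algebra k A] (x : A) :
    pPoly 𝒦 τ x = act (zeroMap 𝒦 A) τ x := by
  let φ : AddMonoid.End A →+ A := AddMonoidHom.mk' (fun e => e x) fun _ _ => rfl
  let g : ℕ → 𝒦 0 →+ A := fun i => φ.comp (monomialAct (p := p) (zeroMap 𝒦 A) i)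
  change liftAddHom g τ = _
  refine induction (P := fun τ => liftAddHom g τ = act (zeroMap 𝒦 A) τ x) τ ?_ ?_ ?_
  · rw [map_zero, act_zero]
  · intro σ τ h h'
    rw [map_add, act_add, h, h']
  · intro i a
    rw [liftAddHom_C_mul_F_pow, act_C_mul_F_pow]
    rfl

variable (n : ℕ) (τ : FrobPoly p (𝒦 0))

/-- The quotient map `k[T_1, T_2] → A(τ)`. -/
def russellMk : MvPolynomial (Fin 2) k →ₐ[k] (russellAlg 𝒦 n τ).carrier :=
  Ideal.Quotient.mkₐ (A := (planeAlg 𝒦).carrier) k (russellIdeal 𝒦 n τ)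

/-- The class of `T_1` in `A(τ)`. -/
def russellX : (russellAlg 𝒦 n τ).carrier := russellMk 𝒦 n τ (MvPolynomial.X 0)

/-- The class of `T_2` in `A(τ)`. -/
def russellY : (russellAlg 𝒦 n τ).carrier := russellMk 𝒦 n τ (MvPolynomial.X 1)

lemma russellX_mem : russellX 𝒦 n τ ∈ (russellAlg 𝒦 n τ).grading 0 :=
  ⟨_, X_mem_degree_zero 𝒦 0, rfl⟩

lemma russellY_mem : russellY 𝒦 n τ ∈ (russellAlg 𝒦 n τ).grading 0 :=
  ⟨_, X_mem_degree_zero 𝒦 1, rfl⟩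

lemma russellMk_surjective : Function.Surjective (russellMk 𝒦 n τ) :=
  Ideal.Quotient.mk_surjective (R := (planeAlg 𝒦).carrier)

lemma russellMk_eq_aeval :
    russellMk 𝒦 n τ = MvPolynomial.aeval ![russellX 𝒦 n τ, russellY 𝒦 n τ] := by
  refine MvPolynomial.algHom_ext fun i => ?_
  rw [MvPolynomial.aeval_X]
  fin_cases i <;> rfl

lemma russellY_pow : russellY 𝒦 n τ ^ p ^ n =
    act (zeroMap 𝒦 (russellAlg 𝒦 n τ).carrier) τ (russellX 𝒦 n τ) := by
  have h : russellMk 𝒦 n τ (MvPolynomial.X 1 ^ p ^ n - pPoly 𝒦 τ (MvPolynomial.X 0)) = 0 :=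
    (Ideal.Quotient.eq_zero_iff_mem (R := (planeAlg 𝒦).carrier)).2 (Ideal.subset_span rfl)
  rw [map_sub, map_pow, pPoly_eq_act, sub_eq_zero] at h
  refine h.trans ?_
  change (russellMk 𝒦 n τ : MvPolynomial (Fin 2) k →+* (russellAlg 𝒦 n τ).carrier) _ = _
  rw [map_act, comp_zeroMap]
  rfl

section Lift

variable {A : Type*} [CommRing A] [Algebra k A]

lemma russell_hom_ext {n} {τ : FrobPoly p (𝒦 0)} {φ ψ : (russellAlg 𝒦 n τ).carrier →ₐ[k] A}
    (hX : φ (russellX 𝒦 n τ) = ψ (russellX 𝒦 n τ)) (hY : φ (russellY 𝒦 n τ) = ψ (russellY 𝒦 n τ)) :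
    φ = ψ := by
  have h : φ.comp (russellMk 𝒦 n τ) = ψ.comp (russellMk 𝒦 n τ) := by
    refine MvPolynomial.algHom_ext fun i => ?_
    fin_cases i
    · exact hX
    · exact hY
  refine AlgHom.ext fun z => ?_
  obtain ⟨z, rfl⟩ := russellMk_surjective 𝒦 n τ z
  exact DFunLike.congr_fun h z

/-- The homomorphism `k[T_1, T_2] → A` with given values on the variables. -/
def planeAeval (x y : A) : (planeAlg 𝒦).carrier →ₐ[k] A :=
  (MvPolynomial.aeval ![x, y] : MvPolynomial (Fin 2) k →ₐ[k] A)

/-- The homomorphism out of `A(τ)` with given values on the generators. -/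
def russellLift (x y : A) (h : y ^ p ^ n = act (zeroMap 𝒦 A) τ x) :
    (russellAlg 𝒦 n τ).carrier →ₐ[k] A :=
  Ideal.Quotient.liftₐ (russellIdeal 𝒦 n τ) (planeAeval 𝒦 x y) fun a ha => by
    refine (Ideal.span_le (I := RingHom.ker (planeAeval 𝒦 x y))).2 ?_ ha
    rintro _ rfl
    change MvPolynomial.aeval ![x, y] (_ - _) = 0
    rw [map_sub, map_pow, pPoly_eq_act, MvPolynomial.aeval_X]
    change y ^ p ^ n - ((MvPolynomial.aeval ![x, y] : MvPolynomial (Fin 2) k →ₐ[k] A) :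
      MvPolynomial (Fin 2) k →+* A) _ = 0
    rw [map_act, comp_zeroMap, h]
    change _ - act _ τ (MvPolynomial.aeval ![x, y] (MvPolynomial.X 0)) = 0
    rw [MvPolynomial.aeval_X]
    exact sub_self _

variable {n τ} {x y : A} (h : y ^ p ^ n = act (zeroMap 𝒦 A) τ x)

lemma russellLift_mk (f : MvPolynomial (Fin 2) k) :
    russellLift 𝒦 n τ x y h (russellMk 𝒦 n τ f) = MvPolynomial.aeval ![x, y] f := rfl

lemma russellLift_X : russellLift 𝒦 n τ x y h (russellX 𝒦 n τ) = x :=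
  MvPolynomial.aeval_X _ _

lemma russellLift_Y : russellLift 𝒦 n τ x y h (russellY 𝒦 n τ) = y :=
  MvPolynomial.aeval_X _ _

lemma exists_russellMk_eq {γ : Γ} {z : (russellAlg 𝒦 n τ).carrier}
    (hz : z ∈ (russellAlg 𝒦 n τ).grading γ) :
    ∃ f ∈ GradedAlg.polyGrading 𝒦 (fun _ : Fin 2 => 0) γ, russellMk 𝒦 n τ f = z := hz

lemma russellLift_mem {𝒜 : Γ → AddSubgroup A} [SetLike.GradedMonoid 𝒜]
    (hA : ∀ γ, ∀ a ∈ 𝒦 γ, algebraMap k A a ∈ 𝒜 γ) (hx : x ∈ 𝒜 0) (hy : y ∈ 𝒜 0) {γ : Γ}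
    {z : (russellAlg 𝒦 n τ).carrier} (hz : z ∈ (russellAlg 𝒦 n τ).grading γ) :
    russellLift 𝒦 n τ x y h z ∈ 𝒜 γ := by
  obtain ⟨f, hf, rfl⟩ := exists_russellMk_eq 𝒦 hz
  rw [russellLift_mk]
  exact aeval_mem_of_mem hA (g := ![x, y]) (Fin.forall_fin_two.2 ⟨hx, hy⟩) hf

end Lift

lemma act_zeroMap_mem {A : Type*} [CommRing A] [Algebra k A] {𝒜 : Γ → AddSubgroup A}
    [SetLike.GradedMonoid 𝒜] (hA : ∀ γ, ∀ a ∈ 𝒦 γ, algebraMap k A a ∈ 𝒜 γ) {x : A}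
    (hx : x ∈ 𝒜 0) : act (zeroMap 𝒦 A) τ x ∈ 𝒜 0 :=
  act_mem (R := 𝒦 0) (f := zeroMap 𝒦 A) (SetLike.GradeZero.subring 𝒜) (fun a => hA 0 _ a.2) τ hx

end Russell
end RussellForms

namespace RussellForms
open FrobPoly
open scoped TensorProduct

/-! ### The polynomial ring and the trivial form. -/

section Disc

variable {Γ : Type*} [AddCommGroup Γ] [DecidableEq Γ] {k : Type*} [CommRing k]
  (𝒦 : Γ → AddSubgroup k) [GradedRing 𝒦]

/-- The variable of `k[T]`. -/
def discT : (discAlg 𝒦).carrier := (MvPolynomial.X () : MvPolynomial Unit k)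

/-- The homomorphism out of `k[T]` with a given value on `T`. -/
def discLift {A : Type*} [CommRing A] [Algebra k A] (t : A) : (discAlg 𝒦).carrier →ₐ[k] A :=
  (MvPolynomial.aeval fun _ => t : MvPolynomial Unit k →ₐ[k] A)

lemma discLift_T {A : Type*} [CommRing A] [Algebra k A] (t : A) :
    discLift 𝒦 t (discT 𝒦) = t := MvPolynomial.aeval_X _ _

lemma disc_hom_ext {A : Type*} [CommRing A] [Algebra k A] {φ ψ : (discAlg 𝒦).carrier →ₐ[k] A}
    (h : φ (discT 𝒦) = ψ (discT 𝒦)) : φ = ψ :=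
  MvPolynomial.algHom_ext (R := k) (σ := Unit) fun _ => h

lemma discLift_mem {A : Type*} [CommRing A] [Algebra k A] {𝒜 : Γ → AddSubgroup A}
    [SetLike.GradedMonoid 𝒜] (hA : ∀ γ, ∀ a ∈ 𝒦 γ, algebraMap k A a ∈ 𝒜 γ) {t : A}
    (ht : t ∈ 𝒜 0) {γ : Γ} {z : (discAlg 𝒦).carrier} (hz : z ∈ (discAlg 𝒦).grading γ) :
    discLift 𝒦 t z ∈ 𝒜 γ :=
  aeval_mem_of_mem hA (fun _ => ht) hz

lemma discT_mem : discT 𝒦 ∈ (discAlg 𝒦).grading 0 := by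
  have h := GradedAlg.monomial_mem_polyGrading 𝒦 (fun _ : Unit => (0 : Γ))
    (I := Finsupp.single () 1) (SetLike.GradedOne.one_mem (A := 𝒦))
  rw [Finsupp.weight_single, smul_zero, add_zero] at h
  exact h

lemma discT_pow_mem (m : ℕ) : discT 𝒦 ^ m ∈ (discAlg 𝒦).grading 0 :=
  (SetLike.GradeZero.subring (discAlg 𝒦).grading).pow_mem (discT_mem 𝒦) m

/-- `A(1)` is the trivial form. -/
lemma russellAlg_one_iso {p : ℕ} [Fact p.Prime] [CharP k p] (n : ℕ) :
    GradedAlg.Iso (russellAlg 𝒦 n (1 : FrobPoly p (𝒦 0))) (discAlg 𝒦) := by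
  have rel : discT 𝒦 ^ p ^ n =
      act (zeroMap 𝒦 (discAlg 𝒦).carrier) (1 : FrobPoly p (𝒦 0)) (discT 𝒦 ^ p ^ n) :=
    (act_one _ _).symm
  refine GradedAlg.Iso.of_algHom (russellLift 𝒦 n 1 _ _ rel) (discLift 𝒦 (russellY 𝒦 n 1))
    (disc_hom_ext 𝒦 ?_) (russell_hom_ext 𝒦 ?_ ?_)
    (fun γ a ha => russellLift_mem 𝒦 rel (fun _ _ => (discAlg 𝒦).algebraMap_mem)
      (discT_pow_mem 𝒦 _) (discT_mem 𝒦) ha)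
    (fun γ a ha => discLift_mem 𝒦 (fun _ _ => (russellAlg 𝒦 n 1).algebraMap_mem)
      (russellY_mem 𝒦 n 1) ha)
  · rw [AlgHom.comp_apply, discLift_T, russellLift_Y]
    rfl
  · rw [AlgHom.comp_apply, russellLift_X, map_pow, discLift_T, russellY_pow, act_one]
    rfl
  · rw [AlgHom.comp_apply, russellLift_Y, discLift_T]
    rfl

end Disc

/-! ### From equivalent twisted polynomials to isomorphic algebras. -/

section Isomorphisms

variable {Γ : Type*} [AddCommGroup Γ] [DecidableEq Γ] {k : Type*} [CommRing k]
  (𝒦 : Γ → AddSubgroup k) [GradedRing 𝒦] [IsGradedField 𝒦] {p : ℕ} [Fact p.Prime] [CharP k p]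
  {n : ℕ}

/-- Equivalent `τ` and `τ'` give isomorphic graded algebras. -/
lemma russellAlg_iso {σ τ τ' ρ : FrobPoly p (𝒦 0)} (hσ : σ ∈ sep p (𝒦 0)) (c : (𝒦 0)ˣ)
    (h : τ' * C (c : 𝒦 0) = twist n σ * τ + F ^ n * ρ) :
    GradedAlg.Iso (russellAlg 𝒦 n τ') (russellAlg 𝒦 n τ) := by
  obtain ⟨β, m, m', h1, h2, h3⟩ := exists_inverse_mod n hσ
  set φ := zeroMap 𝒦 (russellAlg 𝒦 n τ).carrier with hφ
  set φ' := zeroMap 𝒦 (russellAlg 𝒦 n τ').carrier with hφ'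
  set x := russellX 𝒦 n τ with hx
  set y := russellY 𝒦 n τ with hy
  set x' := russellX 𝒦 n τ' with hx'
  set y' := russellY 𝒦 n τ' with hy'
  have hxy : y ^ p ^ n = act φ τ x := russellY_pow 𝒦 n τ
  have hxy' : y' ^ p ^ n = act φ' τ' x' := russellY_pow 𝒦 n τ'
  have hc : φ c * φ ((c⁻¹ : (𝒦 0)ˣ) : 𝒦 0) = 1 := by rw [← map_mul, Units.mul_inv, map_one]
  have hc' : φ' c * φ' ((c⁻¹ : (𝒦 0)ˣ) : 𝒦 0) = 1 := by rw [← map_mul, Units.mul_inv, map_one]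
  -- The relation that allows x' ↦ cx, y' ↦ σ(y) + ρ(x): both sides equal (σ^{(n)}τ + F^nρ)(x).
  have rel' : (act φ σ y + act φ ρ x) ^ p ^ n = act φ τ' (φ c * x) := by
    rw [add_pow_char_pow_of_ringHom φ, act_pow, hxy, ← act_C φ (c : 𝒦 0), ← act_mul, ← act_mul, h,
      act_add, act_mul _ (F ^ n), act_F_pow]
  set X := φ' ((c⁻¹ : (𝒦 0)ˣ) : 𝒦 0) * x' with hX
  have hcX : φ' c * X = x' := by rw [hX, ← mul_assoc, hc', one_mul]
  -- For the inverse, X = c⁻¹x' must be the image of x, so Y must be the image of σ(y). The image w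
  -- of y is then recovered from Y and Y^(p^n) = σ^{(n)}(τ(X)) by inverting σ modulo F^n.
  set Y := y' - act φ' ρ X with hY
  have hYX : Y ^ p ^ n = act φ' (twist n σ) (act φ' τ X) := by
    rw [← act_F_pow φ', hY, map_sub, act_F_pow, hxy', ← act_mul, ← act_mul, ← hcX, ← act_C,
      ← act_mul, h, act_add, add_sub_cancel_right]
  set w := act φ' β Y - act φ' m (act φ' τ X) with hw
  have rel : w ^ p ^ n = act φ' τ X := act_sub_pow φ' h1 hYX
  have hσw : act φ' σ w = Y := act_act_sub φ' h2 h3 hYX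
  let Φ := russellLift 𝒦 n τ' _ _ rel'
  let Ψ := russellLift 𝒦 n τ _ _ rel
  have Φx : Φ x' = φ c * x := russellLift_X 𝒦 rel'
  have Φy : Φ y' = act φ σ y + act φ ρ x := russellLift_Y 𝒦 rel'
  have Ψx : Ψ x = X := russellLift_X 𝒦 rel
  have Ψy : Ψ y = w := russellLift_Y 𝒦 rel
  have Φact (τ : FrobPoly p (𝒦 0)) (z) : Φ (act φ' τ z) = act φ τ (Φ z) :=
    algHom_act_zeroMap 𝒦 Φ τ z
  have Ψact (τ : FrobPoly p (𝒦 0)) (z) : Ψ (act φ τ z) = act φ' τ (Ψ z) :=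
    algHom_act_zeroMap 𝒦 Ψ τ z
  have Φφ (a : 𝒦 0) : Φ (φ' a) = φ a := Φ.commutes (a : k)
  have Ψφ (a : 𝒦 0) : Ψ (φ a) = φ' a := Ψ.commutes (a : k)
  have ΦX : Φ X = x := by
    rw [hX, map_mul, Φφ, Φx, ← mul_assoc, mul_comm (φ _), hc, one_mul]
  have hx0 : x ∈ (russellAlg 𝒦 n τ).grading 0 := russellX_mem 𝒦 n τ
  have hy0 : y ∈ (russellAlg 𝒦 n τ).grading 0 := russellY_mem 𝒦 n τ
  have hX0 : X ∈ (russellAlg 𝒦 n τ').grading 0 := by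
    rw [hX, ← act_C]
    exact act_zeroMap_mem 𝒦 _ (fun _ _ => (russellAlg 𝒦 n τ').algebraMap_mem)
      (russellX_mem 𝒦 n τ')
  have hact {τ₀ : FrobPoly p (𝒦 0)} (τ) {z} (hz : z ∈ (russellAlg 𝒦 n τ₀).grading 0) :
      act (zeroMap 𝒦 (russellAlg 𝒦 n τ₀).carrier) τ z ∈ (russellAlg 𝒦 n τ₀).grading 0 :=
    act_zeroMap_mem 𝒦 τ (fun _ _ => (russellAlg 𝒦 n τ₀).algebraMap_mem) hz
  refine GradedAlg.Iso.of_algHom Φ Ψ (russell_hom_ext 𝒦 ?_ ?_) (russell_hom_ext 𝒦 ?_ ?_)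
    (fun γ a ha => russellLift_mem 𝒦 rel' (fun _ _ => (russellAlg 𝒦 n τ).algebraMap_mem)
      ?_ (add_mem (hact _ hy0) (hact _ hx0)) ha)
    (fun γ a ha => russellLift_mem 𝒦 rel (fun _ _ => (russellAlg 𝒦 n τ').algebraMap_mem)
      hX0 (sub_mem (hact _ (sub_mem (russellY_mem 𝒦 n τ') (hact _ hX0))) (hact _ (hact _ hX0))) ha)
  · change Φ (Ψ x) = x
    rw [Ψx, ΦX]
  · change Φ (Ψ y) = y
    rw [Ψy, hw, map_sub, Φact, Φact, Φact, hY, map_sub, Φact, Φy, ΦX, add_sub_cancel_right, ← hxy]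
    exact act_sub_eq_self φ h1 y
  · change Ψ (Φ x') = x'
    rw [Φx, map_mul, Ψφ, Ψx, hcX]
  · change Ψ (Φ y') = y'
    rw [Φy, map_add, Ψact, Ψact, Ψy, Ψx, hσw, hY, sub_add_cancel]
  · rw [← act_C]
    exact hact _ hx0

end Isomorphisms

/-! ### Trivialising A(τ) over ℓ. -/

section Form

variable {Γ : Type*} [AddCommGroup Γ] [DecidableEq Γ] {k : Type*} [CommRing k]
  (𝒦 : Γ → AddSubgroup k) [GradedRing 𝒦] [IsGradedField 𝒦] {p : ℕ} [Fact p.Prime] [CharP k p]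
  {n : ℕ} {ℓ : Type*} [CommRing ℓ] [Algebra k ℓ] (𝓛 : Γ → AddSubgroup ℓ) [SetLike.GradedMonoid 𝓛]

/-- `A(τ)` becomes a polynomial ring as soon as the coefficients of `τ` have `p ^ n`-th roots. -/
lemma isForm_russellAlg (hℓ : ∀ γ, ∀ a ∈ 𝒦 γ, algebraMap k ℓ a ∈ 𝓛 γ) {E : Type*} [Field E]
    [CharP E p] (j : 𝒦 0 →+* E) (f : E →+* ℓ) (hf : ∀ a, f a ∈ 𝓛 0)
    (hjf : f.comp j = zeroMap 𝒦 ℓ) {τ : FrobPoly p (𝒦 0)} (hτ : τ ∈ sep p (𝒦 0))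
    {b : FrobPoly p E} (hb : twist n b = map j τ) :
    GradedAlg.IsForm 𝓛 (discAlg 𝒦) (russellAlg 𝒦 n τ) := by
  obtain ⟨ρ, h, h', h1, h2, h3⟩ := exists_inverse_mod n (mem_sep_of_twist_eq_map hτ hb)
  set A := russellAlg 𝒦 n τ
  set B := discAlg 𝒦
  set φ : E →+* ℓ ⊗[k] A.carrier := (algebraMap ℓ (ℓ ⊗[k] A.carrier)).comp f with hφ
  set ψ : E →+* ℓ ⊗[k] B.carrier := (algebraMap ℓ (ℓ ⊗[k] B.carrier)).comp f with hψ
  have hφj : φ.comp j = zeroMap 𝒦 (ℓ ⊗[k] A.carrier) := by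
    rw [hφ, RingHom.comp_assoc, hjf]
    exact RingHom.ext fun a => (IsScalarTower.algebraMap_apply k ℓ (ℓ ⊗[k] A.carrier) a.1).symm
  have hψj : ψ.comp j = zeroMap 𝒦 (ℓ ⊗[k] B.carrier) := by
    rw [hψ, RingHom.comp_assoc, hjf]
    exact RingHom.ext fun a => (IsScalarTower.algebraMap_apply k ℓ (ℓ ⊗[k] B.carrier) a.1).symm
  set x : ℓ ⊗[k] A.carrier := 1 ⊗ₜ russellX 𝒦 n τ with hx
  set y : ℓ ⊗[k] A.carrier := 1 ⊗ₜ russellY 𝒦 n τ with hy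
  set t : ℓ ⊗[k] B.carrier := 1 ⊗ₜ discT 𝒦 with ht
  have hxy : y ^ p ^ n = act φ (twist n b) x := by
    have e := congrArg (Algebra.TensorProduct.includeRight : A.carrier →ₐ[k] ℓ ⊗[k] A.carrier)
      (russellY_pow 𝒦 n τ)
    rw [map_pow] at e
    refine e.trans ?_
    rw [hb, act_map, hφj]
    exact algHom_act_zeroMap 𝒦 _ τ _
  have rel : act ψ b t ^ p ^ n = act (zeroMap 𝒦 (ℓ ⊗[k] B.carrier)) τ (t ^ p ^ n) := by
    rw [act_pow, hb, act_map, hψj]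
  let Φ : (ℓ ⊗[k] A.carrier) →ₐ[ℓ] (ℓ ⊗[k] B.carrier) :=
    Algebra.TensorProduct.lift (Algebra.ofId ℓ _) (russellLift 𝒦 n τ _ _ rel)
      fun _ _ => Commute.all _ _
  -- The parameter t recovered from x = t^(p^n) and y = b(t).
  set w := act φ ρ y - act φ h x with hw
  let Ψ : (ℓ ⊗[k] B.carrier) →ₐ[ℓ] (ℓ ⊗[k] A.carrier) :=
    Algebra.TensorProduct.lift (Algebra.ofId ℓ _) (discLift 𝒦 w) fun _ _ => Commute.all _ _
  have Φ1 (a) : Φ (1 ⊗ₜ a) = russellLift 𝒦 n τ _ _ rel a := by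
    rw [Algebra.TensorProduct.lift_tmul, map_one, one_mul]
  have Ψ1 (a) : Ψ (1 ⊗ₜ a) = discLift 𝒦 w a := by
    rw [Algebra.TensorProduct.lift_tmul, map_one, one_mul]
  have Φx : Φ x = t ^ p ^ n := (Φ1 _).trans (russellLift_X 𝒦 rel)
  have Φy : Φ y = act ψ b t := (Φ1 _).trans (russellLift_Y 𝒦 rel)
  have Ψt : Ψ t = w := (Ψ1 _).trans (discLift_T 𝒦 w)
  have Φact (τ : FrobPoly p E) (z) : Φ (act φ τ z) = act ψ τ (Φ z) := algHom_act_algebraMap f Φ τ z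
  have Ψact (τ : FrobPoly p E) (z) : Ψ (act ψ τ z) = act φ τ (Ψ z) := algHom_act_algebraMap f Ψ τ z
  have hℓC (C : GradedAlg 𝒦) : ∀ γ, ∀ a ∈ 𝒦 γ,
      algebraMap k (ℓ ⊗[k] C.carrier) a ∈ GradedAlg.tensorGrading 𝓛 C γ := fun γ a ha => by
    rw [IsScalarTower.algebraMap_apply k ℓ]
    exact GradedAlg.algebraMap_mem_tensorGrading C (hℓ γ a ha)
  have hactC (C : GradedAlg 𝒦) (τ : FrobPoly p E) {z}
      (hz : z ∈ GradedAlg.tensorGrading 𝓛 C 0) :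
      act ((algebraMap ℓ (ℓ ⊗[k] C.carrier)).comp f) τ z ∈ GradedAlg.tensorGrading 𝓛 C 0 :=
    act_mem (R := E) (f := (algebraMap ℓ (ℓ ⊗[k] C.carrier)).comp f)
      (SetLike.GradeZero.subring (GradedAlg.tensorGrading 𝓛 C))
      (fun a => GradedAlg.algebraMap_mem_tensorGrading C (hf a)) τ hz
  have ht0 : t ∈ GradedAlg.tensorGrading 𝓛 B 0 :=
    GradedAlg.one_tmul_mem_tensorGrading (discT_mem 𝒦)
  refine GradedAlg.IsForm.of_algHom Φ Ψ ?_ ?_ (fun γ a ha => ?_) (fun γ a ha => ?_)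
  · refine Algebra.TensorProduct.ext (by ext) (disc_hom_ext 𝒦 ?_)
    change Φ (Ψ t) = t
    rw [Ψt, hw, map_sub, Φact, Φact, Φx, Φy]
    exact act_sub_eq_self ψ h1 t
  · refine Algebra.TensorProduct.ext (by ext) (russell_hom_ext 𝒦 ?_ ?_)
    · change Ψ (Φ x) = x
      rw [Φx, map_pow, Ψt]
      exact act_sub_pow φ h1 hxy
    · change Ψ (Φ y) = y
      rw [Φy, Ψact, Ψt]
      exact act_act_sub φ h2 h3 hxy
  · refine GradedAlg.map_mem_tensorGrading Φ (fun γ a ha => ?_) ha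
    rw [Φ1]
    exact russellLift_mem 𝒦 rel (hℓC B)
      ((SetLike.GradeZero.subring (GradedAlg.tensorGrading 𝓛 B)).pow_mem ht0 _)
      (hactC B b ht0) ha
  · refine GradedAlg.map_mem_tensorGrading Ψ (fun γ a ha => ?_) ha
    rw [Ψ1]
    exact discLift_mem 𝒦 (hℓC A) (sub_mem
      (hactC A ρ (GradedAlg.one_tmul_mem_tensorGrading (russellY_mem 𝒦 n τ)))
      (hactC A h (GradedAlg.one_tmul_mem_tensorGrading (russellX_mem 𝒦 n τ)))) ha

end Form
end RussellForms

namespace RussellForms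
open FrobPoly

lemma map_planeEval {R A B : Type*} [CommRing R] [CommRing A] [CommRing B] (f : R →+* A)
    (g : A →+* B) (x y : A) (P : Polynomial (Polynomial R)) :
    g (planeEval f x y P) = planeEval (g.comp f) (g x) (g y) P :=
  DFunLike.congr_fun (f := g.comp (planeEval f x y)) (ringHom_ext_plane
    (by simp [planeEval]) (by simp [planeEval]) (by simp [planeEval])) P

/-! ### From isomorphic algebras to equivalent twisted polynomials. -/

section Classification

variable {Γ : Type*} [AddCommGroup Γ] [DecidableEq Γ] {k : Type*} [CommRing k]
  (𝒦 : Γ → AddSubgroup k) [GradedRing 𝒦] {p : ℕ} [Fact p.Prime] [CharP k p] {n : ℕ}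

/-- The part of trivial degree of `A(τ)` is generated over that of `k` by the two generators. -/
lemma exists_planeEval_eq {τ : FrobPoly p (𝒦 0)} {z : (russellAlg 𝒦 n τ).carrier}
    (hz : z ∈ (russellAlg 𝒦 n τ).grading 0) : ∃ P : Polynomial (Polynomial (𝒦 0)),
      planeEval (zeroMap 𝒦 (russellAlg 𝒦 n τ).carrier) (russellX 𝒦 n τ) (russellY 𝒦 n τ) P = z := by
  obtain ⟨f, hf, rfl⟩ := exists_russellMk_eq 𝒦 hz
  rw [russellMk_eq_aeval, MvPolynomial.aeval_def, MvPolynomial.eval₂_eq]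
  set S := (planeEval (zeroMap 𝒦 (russellAlg 𝒦 n τ).carrier) (russellX 𝒦 n τ)
    (russellY 𝒦 n τ)).range
  refine S.sum_mem fun I _ => S.mul_mem ?_
    (S.prod_mem fun i _ => S.pow_mem ?_ _)
  · have h0 : Finsupp.weight (fun _ : Fin 2 => (0 : Γ)) I = 0 := by
      rw [Finsupp.weight_apply]
      exact Finset.sum_eq_zero fun i _ => smul_zero _
    have h1 := hf I
    rw [h0, sub_zero] at h1
    exact ⟨Polynomial.C (Polynomial.C ⟨_, h1⟩), planeEval_C_C _ _ _ _⟩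
  · revert i
    refine fun i _ => ?_
    fin_cases i
    · exact ⟨Polynomial.C Polynomial.X, planeEval_C_X _ _ _⟩
    · exact ⟨Polynomial.X, planeEval_X _ _ _⟩

/-- Isomorphic algebras `A(τ')` and `A(τ)` come from equivalent `τ'` and `τ`. -/
lemma exists_of_russellAlg_iso [IsGradedField 𝒦] (hn : n ≠ 0) {ℓ : Type*} [CommRing ℓ]
    [Nontrivial ℓ] [Algebra k ℓ] {E : Type*} [Field E] [CharP E p] (j : 𝒦 0 →+* E) (f : E →+* ℓ)
    (hjf : f.comp j = zeroMap 𝒦 ℓ) {τ τ' : FrobPoly p (𝒦 0)} (hτ : τ ∈ sep p (𝒦 0))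
    (hτ' : τ' ∈ sep p (𝒦 0)) {b b' : FrobPoly p E} (hb : twist n b = map j τ)
    (hb' : twist n b' = map j τ')
    (h : GradedAlg.Iso (russellAlg 𝒦 n τ') (russellAlg 𝒦 n τ)) :
    ∃ σ ∈ sep p (𝒦 0), ∃ (c : (𝒦 0)ˣ) (ρ : FrobPoly p (𝒦 0)),
      τ' * C (c : 𝒦 0) = twist n σ * τ + F ^ n * ρ := by
  obtain ⟨e, he⟩ := h
  have he' (γ z) (hz : z ∈ (russellAlg 𝒦 n τ).grading γ) :
      e.symm z ∈ (russellAlg 𝒦 n τ').grading γ := by rwa [← he, e.apply_symm_apply]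
  obtain ⟨P, hP⟩ := exists_planeEval_eq 𝒦 ((he 0 _).2 (russellX_mem 𝒦 n τ'))
  obtain ⟨Q, hQ⟩ := exists_planeEval_eq 𝒦 ((he 0 _).2 (russellY_mem 𝒦 n τ'))
  obtain ⟨P', hP'⟩ := exists_planeEval_eq 𝒦 (he' 0 _ (russellX_mem 𝒦 n τ))
  obtain ⟨Q', hQ'⟩ := exists_planeEval_eq 𝒦 (he' 0 _ (russellY_mem 𝒦 n τ))
  -- A(τ) is a k-algebra while E[T] need not be one, so the generators are sent to ℓ[T]. Their
  -- images come from E[T], and identities are pulled back along the injection g; injectivity of the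
  -- map from A(τ) is not needed.
  let g : Polynomial E →+* Polynomial ℓ := Polynomial.mapRingHom f
  have hg : Function.Injective g := Polynomial.map_injective f f.injective
  have hgj : g.comp (Polynomial.C.comp j) = zeroMap 𝒦 (Polynomial ℓ) := by
    refine RingHom.ext fun a => ?_
    have h1 : f (j a) = algebraMap k ℓ (a : k) := DFunLike.congr_fun hjf a
    change Polynomial.map f (Polynomial.C (j a)) = algebraMap k (Polynomial ℓ) (a : k)
    rw [Polynomial.map_C, h1]
    rfl
  have rel : g (additivePoly b) ^ p ^ n =
      act (zeroMap 𝒦 (Polynomial ℓ)) τ (g (Polynomial.X ^ p ^ n)) := by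
    rw [← map_pow, additivePoly, act_pow, hb, act_map, map_act, hgj]
  let Ψ := russellLift 𝒦 n τ _ _ rel
  have ΨX : Ψ (russellX 𝒦 n τ) = g (Polynomial.X ^ p ^ n) := russellLift_X 𝒦 rel
  have ΨY : Ψ (russellY 𝒦 n τ) = g (additivePoly b) := russellLift_Y 𝒦 rel
  let Φ : (russellAlg 𝒦 n τ').carrier →ₐ[k] Polynomial ℓ := Ψ.comp e
  have Ψeval (P) : Ψ (planeEval (zeroMap 𝒦 _) (russellX 𝒦 n τ) (russellY 𝒦 n τ) P) =
      g (planeEval (Polynomial.C.comp j) (Polynomial.X ^ p ^ n) (additivePoly b) P) := by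
    rw [map_planeEval, hgj, ← ΨX, ← ΨY, ← comp_zeroMap 𝒦 Ψ]
    exact map_planeEval _ (Ψ : (russellAlg 𝒦 n τ).carrier →+* Polynomial ℓ) _ _ P
  set u := planeEval (Polynomial.C.comp j) (Polynomial.X ^ p ^ n) (additivePoly b) P with hu
  set v := planeEval (Polynomial.C.comp j) (Polynomial.X ^ p ^ n) (additivePoly b) Q with hv
  have Φu : Φ (russellX 𝒦 n τ') = g u := by rw [hu, ← Ψeval, hP]; rfl
  have Φv : Φ (russellY 𝒦 n τ') = g v := by rw [hv, ← Ψeval, hQ]; rfl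
  have Φeval (P) : g (planeEval (Polynomial.C.comp j) u v P) =
      Φ (planeEval (zeroMap 𝒦 _) (russellX 𝒦 n τ') (russellY 𝒦 n τ') P) := by
    rw [map_planeEval, hgj, ← Φu, ← Φv, ← comp_zeroMap 𝒦 Φ]
    exact (map_planeEval _ (Φ : (russellAlg 𝒦 n τ').carrier →+* Polynomial ℓ) _ _ P).symm
  have Φsymm (z) : Φ (e.symm z) = Ψ z := congrArg Ψ (e.apply_symm_apply z)
  refine exists_twist_mul_add j hn hτ hτ' hb hb' (u := u) (v := v) (hg ?_) Q rfl P' Q'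
    (hg ?_) (hg ?_)
  · rw [map_act, hgj, map_pow, ← Φu, ← Φv, ← map_pow, russellY_pow, algHom_act_zeroMap]
  · rw [Φeval, hP', Φsymm, ΨX]
  · rw [Φeval, hQ', Φsymm, ΨY]

end Classification

/-! ### The orbit relation on V_n. -/

section Orbits

variable {p : ℕ} [Fact p.Prime] {R : Type*} [Field R] [CharP R p] {n : ℕ}

lemma V.mk_surjective (v : V p R n) : ∃ τ, V.mk n τ = v := by
  obtain ⟨_, τ, hτ, rfl⟩ := v
  exact ⟨⟨τ, hτ⟩, rfl⟩

/-- Moving c to the other side removes the inverse from the action; the right ideal F^n R[F] is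
stable under right multiplication by c and c⁻¹. -/
lemma V.mk_mem_orbit_iff (τ τ' : sep p R) :
    (V.mk n τ' : V p R n) ∈ MulAction.orbit (G p R n) (V.mk n τ) ↔
      ∃ σ ∈ sep p R, ∃ (c : Rˣ) (ρ : FrobPoly p R),
        τ'.1 * C (c : R) = twist n σ * τ.1 + F ^ n * ρ := by
  constructor
  · rintro ⟨⟨⟨_, σ, hσ, rfl⟩, c⟩, h⟩
    have h1 := (smul_mk n ⟨σ, hσ⟩ τ c).symm.trans (congrArg Subtype.val h)
    obtain ⟨ρ, hρ⟩ := QuotientAddGroup.eq.1 h1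
    refine ⟨σ, hσ, c, ρ * C (c : R), ?_⟩
    change F ^ n * ρ = _ at hρ
    rw [← mul_assoc, hρ, add_mul, neg_mul, mul_assoc _ _ (C (c : R)), ← map_mul, Units.inv_mul,
      map_one, mul_one]
    exact (add_neg_cancel_left _ _).symm
  · rintro ⟨σ, hσ, c, ρ, h⟩
    refine ⟨(U.mk n ⟨σ, hσ⟩, c), Subtype.ext ((smul_mk n ⟨σ, hσ⟩ τ c).trans ?_)⟩
    refine QuotientAddGroup.eq.2 ⟨ρ * C ((c⁻¹ : Rˣ) : R), ?_⟩
    have e : τ'.1 = (twist n σ * τ.1 + F ^ n * ρ) * C ((c⁻¹ : Rˣ) : R) := by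
      rw [← h, mul_assoc, ← map_mul, Units.mul_inv, map_one, mul_one]
    change F ^ n * (ρ * C ((c⁻¹ : Rˣ) : R)) = _ + τ'.1
    rw [e, add_mul, neg_add_cancel_left, mul_assoc]

end Orbits

universe u

/-! ### A field of coefficients in ℓ containing all p^n-th roots of k_1. -/

section RootField

variable {Γ : Type*} [AddCommGroup Γ] [DecidableEq Γ] {k : Type*} [CommRing k]
  (𝒦 : Γ → AddSubgroup k) [GradedRing 𝒦] (p : ℕ) [Fact p.Prime] [CharP k p]
  {K : Type u} [CommRing K] [Algebra k K] (𝒦bar : Γ → AddSubgroup K) (n : ℕ)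

instance [SetLike.GradedMonoid 𝒦bar] : SetLike.GradedMonoid (rootGrading p k 𝒦bar n) where
  one_mem := SetLike.GradedOne.one_mem (A := 𝒦bar)
  mul_mem _ _ _ _ hx hy := SetLike.GradedMul.mul_mem (A := 𝒦bar) hx hy

/-- The part of trivial degree of `k^{p^{-n}}` is a field in which all elements of `k_1` have
`p ^ n`-th roots. -/
lemma exists_rootField [GradedRing 𝒦bar] [IsGradedField 𝒦] (hK : IsGradedAlgClosure 𝒦 𝒦bar) :
    ∃ (E : Type u) (_ : Field E) (_ : CharP E p) (j : 𝒦 0 →+* E)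
      (f : E →+* rootExt p k K n), (∀ a, f a ∈ rootGrading p k 𝒦bar n 0) ∧
      f.comp j = zeroMap 𝒦 (rootExt p k K n) ∧
      ∀ τ : FrobPoly p (𝒦 0), ∃ b : FrobPoly p E, twist n b = map j τ := by
  have := hK.isGradedField
  have := IsGradedField.nontrivial (𝒦 := 𝒦bar)
  have : CharP K p := (CharP.charP_iff_prime_eq_zero Fact.out).2 (by
    rw [← map_natCast (algebraMap k K), CharP.cast_eq_zero, map_zero])
  have hq : 0 < p ^ n := pow_pos (Fact.out : p.Prime).pos n
  let j₀ : 𝒦 0 →+* 𝒦bar 0 := (zeroMap 𝒦 K).codRestrict (SetLike.GradeZero.subring 𝒦bar)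
    fun a => hK.algebraMap_mem a.2
  -- Being the preimage of a subfield under a power of Frobenius, E is itself a field.
  let E : Subfield (𝒦bar 0) := j₀.fieldRange.comap (iterateFrobenius (𝒦bar 0) p n)
  have hE (a : 𝒦bar 0) : a ∈ E ↔ ∃ r, j₀ r = a ^ p ^ n := Iff.rfl
  have hcE : CharP E p := (CharP.charP_iff_prime_eq_zero Fact.out).2
    (Subtype.ext (CharP.cast_eq_zero (𝒦bar 0) p))
  let j : 𝒦 0 →+* E := j₀.codRestrict E fun a => (hE _).2 ⟨a ^ p ^ n, map_pow _ _ _⟩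
  let f : E →+* rootExt p k K n :=
    ((SetLike.GradeZero.subring 𝒦bar).subtype.comp E.subtype).codRestrict (rootExt p k K n) (by
      rintro ⟨a, r, hr⟩
      exact ⟨(r : k), congrArg Subtype.val hr⟩)
  refine ⟨E, inferInstance, hcE, j, f, fun a => a.1.2, rfl, fun τ => exists_twist_eq n _ fun i => ?_⟩
  rw [coeff_map]
  generalize coeff τ i = r
  -- A homogeneous root of trivial degree of X^(p^n) - r, whose coefficients all have trivial
  -- degree.
  obtain ⟨x, hx, hroot⟩ := hK.exists_root 0 0
    (Polynomial.X ^ p ^ n - Polynomial.C (algebraMap k K (r : k))) (fun l => by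
      rw [smul_zero, sub_zero, Polynomial.coeff_sub, Polynomial.coeff_X_pow, Polynomial.coeff_C]
      refine sub_mem ?_ ?_
      · split_ifs
        · exact SetLike.GradedOne.one_mem
        · exact zero_mem _
      · split_ifs
        · exact hK.algebraMap_mem r.2
        · exact zero_mem _)
    (by rwa [Polynomial.natDegree_X_pow_sub_C])
  have hx' : x ^ p ^ n = algebraMap k K (r : k) := by
    simpa [Polynomial.IsRoot.def, sub_eq_zero] using hroot
  have hx₀ : j₀ r = (⟨x, hx⟩ : 𝒦bar 0) ^ p ^ n := Subtype.ext hx'.symm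
  exact ⟨⟨⟨x, hx⟩, _, hx₀⟩, Subtype.ext hx₀.symm⟩

end RootField
end RussellForms

end

/-! ### The injection of pointed sets. -/

open RussellForms in
theorem mainTheorem4 {k : Type*} [CommRing k] (𝒦 : Additive {x : ℝ // 0 < x} → AddSubgroup k)
    [GradedRing 𝒦] [IsGradedField 𝒦] (p : ℕ) [Fact p.Prime] [CharP k p]
    {K : Type*} [CommRing K] [Algebra k K] (𝒦bar : Additive {x : ℝ // 0 < x} → AddSubgroup K)
    [GradedRing 𝒦bar] (hK : IsGradedAlgClosure 𝒦 𝒦bar) (n : ℕ) (hn : 1 ≤ n) :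
    ∃ hform : ∀ τ : FrobPoly.sep p (𝒦 0),
        GradedAlg.IsForm (rootGrading p k 𝒦bar n) (discAlg 𝒦) (russellAlg 𝒦 n τ.1),
    ∃ ι : MulAction.orbitRel.Quotient (FrobPoly.G p (𝒦 0) n) (FrobPoly.V p (𝒦 0) n) →
        GradedAlg.H1 (rootGrading p k 𝒦bar n) (discAlg 𝒦),
      (∀ τ : FrobPoly.sep p (𝒦 0),
        ι (Quotient.mk _ (FrobPoly.V.mk n τ)) =
          GradedAlg.H1.mk (rootGrading p k 𝒦bar n) (discAlg 𝒦) (russellAlg 𝒦 n τ.1) (hform τ)) ∧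
      ι (Quotient.mk _ (FrobPoly.V.mk n 1)) =
        GradedAlg.H1.base (rootGrading p k 𝒦bar n) (discAlg 𝒦) ∧
      Function.Injective ι := by
  have := hK.isGradedField
  have := IsGradedField.nontrivial (𝒦 := 𝒦bar)
  obtain ⟨E, _, _, j, f, hf, hjf, hE⟩ := exists_rootField 𝒦 p 𝒦bar n hK
  have hform (τ : FrobPoly.sep p (𝒦 0)) :
      GradedAlg.IsForm (rootGrading p k 𝒦bar n) (discAlg 𝒦) (russellAlg 𝒦 n τ.1) := by
    obtain ⟨b, hb⟩ := hE τ.1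
    exact isForm_russellAlg 𝒦 (rootGrading p k 𝒦bar n) (fun γ a ha => hK.algebraMap_mem ha) j f hf hjf τ.2 hb
  have hiso (τ τ' : FrobPoly.sep p (𝒦 0)) :
      (FrobPoly.V.mk n τ' : FrobPoly.V p (𝒦 0) n) ∈
        MulAction.orbit (FrobPoly.G p (𝒦 0) n) (FrobPoly.V.mk n τ) ↔
      GradedAlg.Iso (russellAlg 𝒦 n τ'.1) (russellAlg 𝒦 n τ.1) := by
    rw [V.mk_mem_orbit_iff]
    constructor
    · rintro ⟨σ, hσ, c, ρ, h⟩
      exact russellAlg_iso 𝒦 hσ c h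
    · intro h
      obtain ⟨b, hb⟩ := hE τ.1
      obtain ⟨b', hb'⟩ := hE τ'.1
      exact exists_of_russellAlg_iso 𝒦 (Nat.one_le_iff_ne_zero.1 hn) j f hjf τ.2 τ'.2 hb hb' h
  -- The map is defined through arbitrary representatives; `hiso` shows that the resulting class
  -- depends neither on them nor on the point of the orbit.
  choose s hs using V.mk_surjective (p := p) (R := 𝒦 0) (n := n)
  let ι : MulAction.orbitRel.Quotient (FrobPoly.G p (𝒦 0) n) (FrobPoly.V p (𝒦 0) n) →
      GradedAlg.H1 (rootGrading p k 𝒦bar n) (discAlg 𝒦) :=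
    Quotient.lift (fun v => GradedAlg.H1.mk _ _ (russellAlg 𝒦 n (s v).1) (hform (s v)))
      fun v v' h => Quotient.sound ((hiso _ _).1 (by rw [hs, hs]; exact h))
  have hι (τ : FrobPoly.sep p (𝒦 0)) : ι (Quotient.mk _ (FrobPoly.V.mk n τ)) =
      GradedAlg.H1.mk (rootGrading p k 𝒦bar n) (discAlg 𝒦) (russellAlg 𝒦 n τ.1) (hform τ) :=
    Quotient.sound ((hiso _ _).1 (by rw [hs]; exact MulAction.mem_orbit_self _))
  refine ⟨hform, ι, hι, (hι 1).trans (Quotient.sound (russellAlg_one_iso 𝒦 n)), ?_⟩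
  intro a a'
  induction a using Quotient.inductionOn with | _ v
  induction a' using Quotient.inductionOn with | _ v'
  obtain ⟨τ, rfl⟩ := V.mk_surjective v
  obtain ⟨τ', rfl⟩ := V.mk_surjective v'
  intro h
  rw [hι, hι] at h
  exact Quotient.sound ((hiso _ _).2 (Quotient.exact h))
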